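/- Let $q\ge 1$ be an integer and $H\in(\tfrac12,1)$. Let $(B_y)_{y\in\mathbb R}$ be a two-sided Brownian motion and let $I_q$ denote the multiple Wiener--Itô integral of order $q$ with respect to $B$. For $u\in\mathbb R$ and $y=(y_1,\dots,y_q)\in\mathbb R^q$ put $$f_u(y)=c_{q,H}\prod_{i=1}^q (u-y_i)_+^{-\left(\frac12+\frac{1-H}{q}\right)},$$ where $c_{q,H}>0$ is the constant for which the Hermite process $Z_t=I_q\big(\int_0^t f_u\,du\big)$, $t\ge0$, of order $q$ and Hurst parameter $H$ satisfies $\mathbf E[Z_t^2]=t^{2H}$. Let $\Psi:\mathbb R\to\mathbb R$ be continuously differentiable, supported in $[0,1]$, with $\int_{\mathbb R}\Psi(x)\,dx=0$. For real $a,M>0$ and an integer $k\ge 0$ the wavelet coefficient $c(a,k)=\sqrt a\int_{\mathbb R}\Psi(x)Z_{a(x+k)}\,dx$ splits as $c(a,k)=\widetilde{c(a,k,M)}+\widecheck{c(a,k,M)}$, where the second part is $$\widecheck{c(a,k,M)}=I_q\left(\sqrt a\int_{\mathbb R}\Psi(x)\,\mathbf 1_{(-\infty,a(k+1))^q\setminus(a(k-M),a(k+1))^q}\int_{ak}^{a(x+k)}f_u\,du\,dx\right).$$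 Then there is a constant $C(q,H)>0$, depending only on $q$ and $H$, such that for all such $\Psi$, all $a,M>0$ and all integers $k\ge 0$, the kernel above belongs to $L^2(\mathbb R^q)$, so that $\widecheck{c(a,k,M)}$ is a well-defined square-integrable random variable, and $$\mathbf E\left[\widecheck{c(a,k,M)}^2\right]\le C(q,H)\,\|\Psi\|_{L^1(\mathbb R)}^2\,a^{2H+1}(M+1)^{\frac{2H-2}{q}}.$$ In particular, for a fixed $\Psi$ the factor $\|\Psi\|_{L^1(\mathbb R)}^2$ is a constant, and it is at most $1$ if $\|\Psi\|_{L^2(\mathbb R)}=1$. -/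

import Mathlib

open MeasureTheory ProbabilityTheory Filter Set
open scoped ENNReal NNReal Topology Nat

noncomputable section

namespace HermiteWavelet

/-- A two-sided standard real Brownian motion `(B y)_{y ∈ ℝ}` on `(Ω, P)`: it vanishes at `0`, its
increments over disjoint intervals of the whole real line are independent and centered Gaussian with
variance equal to the length of the interval, and its paths are almost surely continuous. -/
structure IsTwoSidedBrownianMotion {Ω : Type*} [MeasurableSpace Ω] (B : ℝ → Ω → ℝ)
    (P : Measure Ω) : Prop where
  eval_zero : ∀ᵐ ω ∂P, B 0 ω = 0
  indep_increments : HasIndepIncrements B P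
  law_increments : ∀ s t : ℝ, s ≤ t →
    HasLaw (fun ω => B t ω - B s ω) (gaussianReal 0 (t - s).toNNReal) P
  continuous_paths : ∀ᵐ ω ∂P, Continuous fun y => B y ω

/-! ### Multiple Wiener-Itô integrals -/

/-- An elementary kernel on `ℝ^q`: a linear combination of indicators of the boxes of a finite grid
`t 0 < t 1 < ⋯ < t m`, whose coefficients vanish on all boxes that meet the diagonals, that is, on
the boxes that use some interval of the grid twice. -/
structure ElementaryKernel (q : ℕ) where
  m : ℕ
  grid : Fin (m + 1) → ℝ
  grid_strictMono : StrictMono grid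
  coeff : (Fin q → Fin m) → ℝ
  coeff_diagonal : ∀ j : Fin q → Fin m, ¬ Function.Injective j → coeff j = 0

/-- The function
`∑_{j_1,…,j_q} a_{j_1,…,j_q} 1_{(t_{j_1}, t_{j_1 + 1}]} ⊗ ⋯ ⊗ 1_{(t_{j_q}, t_{j_q + 1}]}`. -/
def ElementaryKernel.toFun {q : ℕ} (g : ElementaryKernel q) (y : Fin q → ℝ) : ℝ :=
  ∑ j : Fin q → Fin g.m, g.coeff j *
    ∏ i : Fin q, (Ioc (g.grid (j i).castSucc) (g.grid (j i).succ)).indicator (fun _ => (1 : ℝ)) (y i)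

/-- The multiple integral of an elementary kernel,
`∑_{j_1,…,j_q} a_{j_1,…,j_q} (B_{t_{j_1 + 1}} - B_{t_{j_1}}) ⋯ (B_{t_{j_q + 1}} - B_{t_{j_q}})`. -/
def ElementaryKernel.integral {q : ℕ} (g : ElementaryKernel q) {Ω : Type*} (B : ℝ → Ω → ℝ)
    (ω : Ω) : ℝ :=
  ∑ j : Fin q → Fin g.m, g.coeff j *
    ∏ i : Fin q, (B (g.grid (j i).succ) ω - B (g.grid (j i).castSucc) ω)

/-- `X` is (a version of) the multiple Wiener-Itô integral of order `q` of `f ∈ L²(ℝ^q)` with respect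
to `B`: the `L²(P)`-limit of the integrals of elementary kernels that converge to `f` in
`L²(ℝ^q)`. The function `f` need not be symmetric. -/
def IsMultipleIntegral {Ω : Type*} [MeasurableSpace Ω] (P : Measure Ω) (B : ℝ → Ω → ℝ) {q : ℕ}
    (f : (Fin q → ℝ) → ℝ) (X : Ω → ℝ) : Prop :=
  MemLp f 2 volume ∧ MemLp X 2 P ∧
    ∃ g : ℕ → ElementaryKernel q,
      Tendsto (fun n => eLpNorm (fun y => (g n).toFun y - f y) 2 volume) atTop (𝓝 0) ∧
      Tendsto (fun n => eLpNorm (fun ω => (g n).integral B ω - X ω) 2 P) atTop (𝓝 0)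

open Classical in
/-- The multiple Wiener-Itô integral `I_q(f)`; it is `0` by convention if there is no integral. -/
def multipleIntegral {Ω : Type*} [MeasurableSpace Ω] (P : Measure Ω) (B : ℝ → Ω → ℝ) {q : ℕ}
    (f : (Fin q → ℝ) → ℝ) : Ω → ℝ :=
  if h : ∃ X : Ω → ℝ, IsMultipleIntegral P B f X then h.choose else 0

/-! ### The kernel of the Hermite process -/

/-- `∏_{i=1}^q (u - y_i)_+^{-(1/2 + (1 - H)/q)}`, where `x_+^p` is `x^p` for `x > 0` and `0` for
`x ≤ 0`. -/
def productKernel (q : ℕ) (H u : ℝ) (y : Fin q → ℝ) : ℝ :=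
  ∏ i : Fin q, if y i < u then (u - y i) ^ (-(1 / 2 + (1 - H) / q)) else 0

/-- The normalizing constant `c_{q,H} > 0`, chosen such that the Hermite process
`Z_t = I_q (c_{q,H} ∫_0^t productKernel q H u du)` has variance `q! ‖L_t‖² = t^{2H}`. By
self-similarity it is enough to impose this at `t = 1`. -/
def normConst (q : ℕ) (H : ℝ) : ℝ :=
  (√((q ! : ℝ) * ∫ y : Fin q → ℝ, (∫ u in (0 : ℝ)..1, productKernel q H u y) ^ 2))⁻¹

/-- The function `f_u (y_1, …, y_q) = c_{q,H} ∏_{i=1}^q (u - y_i)_+^{-(1/2 + (1 - H)/q)}`. The kernel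
of the Hermite process at time `t` is `L_t = ∫_0^t f_u du`, so that `L_t - L_s = ∫_s^t f_u du`. -/
def hermiteKernel (q : ℕ) (H u : ℝ) (y : Fin q → ℝ) : ℝ :=
  normConst q H * productKernel q H u y

/-! ### The part of the wavelet coefficient with kernel away from a cube -/

/-- The set `(-∞, a (k + 1))^q \ (a (k - M), a (k + 1))^q`. -/
def outerRegion (q : ℕ) (a M : ℝ) (k : ℕ) : Set (Fin q → ℝ) :=
  (Set.pi univ fun _ => Iio (a * (k + 1))) \
    (Set.pi univ fun _ => Ioo (a * (k - M)) (a * (k + 1)))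

/-- The kernel of the second part of the wavelet coefficient `c(a, k)`:
`√a ∫ Ψ(x) 1_{(-∞, a(k+1))^q \ (a(k-M), a(k+1))^q} (y) (∫_{ak}^{a(x+k)} f_u(y) du) dx`. -/
def checkKernel (q : ℕ) (H : ℝ) (Ψ : ℝ → ℝ) (a M : ℝ) (k : ℕ) (y : Fin q → ℝ) : ℝ :=
  √a * ∫ x : ℝ, Ψ x * (outerRegion q a M k).indicator
    (fun z => ∫ u in (a * k)..(a * (x + k)), hermiteKernel q H u z) y

/-- The second part `č(a, k, M)` of the wavelet coefficient `c(a, k)`, as a multiple integral. -/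
def checkCoeff {Ω : Type*} [MeasurableSpace Ω] (P : Measure Ω) (B : ℝ → Ω → ℝ) (q : ℕ) (H : ℝ)
    (Ψ : ℝ → ℝ) (a M : ℝ) (k : ℕ) : Ω → ℝ :=
  multipleIntegral P B (checkKernel q H Ψ a M k)

end HermiteWavelet

end

/-! Put `β = 1/2 + (1 - H)/q`. The kernel is dominated on the outer region by `√a |c| ‖Ψ‖₁ ∫ ∏ᵢ (u -
yᵢ)₊^(-β) du` over `u ∈ (ak, ak + a]`. Squaring and Tonelli leave a double integral in `u, v` of
overlaps of product functions. In one dimension the overlap `∫ (u - s)₊^(-β) (v - s)₊^(-β) ds` is at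
most a constant times `|u - v|^(1 - 2β)`, where `1 - 2β = (2H - 2)/q`. A point of the outer region
has a coordinate at most `ak - aM`, and restricting that one overlap gains a factor of order `(M +
1)^((2H - 2)/q)` (`setLIntegral_coordKernel_mul_le_rpow`, `setLIntegral_prod_le_of_exists_mem`). The
`q` overlaps multiply to `|u - v|^(2H - 2)`, whose integral over the square is of order `a^(2H)`
because `2H - 2 > -1`; the square of `√a` supplies the last power of `a`
(`exists_lintegral_checkKernel_sq_le`).

For the random variable only a bound `‖I_q(f)‖ ≤ K ‖f‖` is needed, not the exact isometry. It holds
for elementary kernels by independence of the increments and vanishing on the diagonals. Common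
refinements give it for differences (`eLpNorm_integral_sub_le`), and density of elementary kernels
yields existence and the bound on all of `L²` (`exists_isMultipleIntegral`,
`IsMultipleIntegral.eLpNorm_le`). -/

namespace HermiteWavelet

/-! ### Refinements and differences of elementary kernels -/

namespace ElementaryKernel

variable {q : ℕ}

/-- The sum `∑_j a_j ∏_i (F_i (t_{j_i + 1}) - F_i (t_{j_i}))`, which specializes both to the step
function of the kernel and to its multiple integral. -/
def eval (g : ElementaryKernel q) (F : Fin q → ℝ → ℝ) : ℝ :=
  ∑ j : Fin q → Fin g.m, g.coeff j *
    ∏ i : Fin q, (F i (g.grid (j i).succ) - F i (g.grid (j i).castSucc))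

theorem integral_eq_eval (g : ElementaryKernel q) {Ω : Type*} (B : ℝ → Ω → ℝ) (ω : Ω) :
    g.integral B ω = g.eval fun _ t => B t ω := rfl

/-- With `F = 1_{[y, ∞)}` an increment of `F` detects `y`, so identities for `eval` valid for every
`F` apply at once to the step function and to its integral. -/
theorem indicator_Ioc_eq_sub {s t : ℝ} (h : s ≤ t) (y : ℝ) :
    (Ioc s t).indicator (fun _ => (1 : ℝ)) y =
      (Ici y).indicator (fun _ => 1) t - (Ici y).indicator (fun _ => 1) s := by
  simp only [indicator, mem_Ioc, mem_Ici]
  grind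

theorem toFun_eq_eval (g : ElementaryKernel q) (y : Fin q → ℝ) :
    g.toFun y = g.eval fun i => (Ici (y i)).indicator fun _ => 1 := by
  unfold toFun eval
  refine Finset.sum_congr rfl fun j _ => ?_
  congr 1
  refine Finset.prod_congr rfl fun i _ => indicator_Ioc_eq_sub ?_ _
  exact (g.grid_strictMono (Fin.castSucc_lt_succ)).le

theorem sum_sub_of_grid {n : ℕ} {s : Fin (n + 1) → ℝ} (hs : StrictMono s) (F : ℝ → ℝ)
    {p r : Fin (n + 1)} (hpr : p ≤ r) :
    ∑ k : Fin n, (if s p ≤ s k.castSucc ∧ s k.succ ≤ s r then (1 : ℝ) else 0) *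
      (F (s k.succ) - F (s k.castSucc)) = F (s r) - F (s p) := by
  -- `F ∘ s` extended to `ℕ` for telescoping over `[p, r)`; the default `0` is never reached, as `r
  -- ≤ n`.
  set G : ℕ → ℝ := fun i => if h : i < n + 1 then F (s ⟨i, h⟩) else 0 with hG
  have h1 : ∀ k : Fin n, (if s p ≤ s k.castSucc ∧ s k.succ ≤ s r then (1 : ℝ) else 0) *
      (F (s k.succ) - F (s k.castSucc)) =
      (fun i : ℕ => if i ∈ Finset.Ico (p : ℕ) r then G (i + 1) - G i else 0) k := by
    intro k
    have e1 : G (k + 1) = F (s k.succ) := by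
      simp only [hG]; rw [dif_pos (by omega)]; rfl
    have e2 : G k = F (s k.castSucc) := by
      simp only [hG]; rw [dif_pos (by omega)]; rfl
    have e3 : (s p ≤ s k.castSucc ∧ s k.succ ≤ s r) ↔ (k : ℕ) ∈ Finset.Ico (p : ℕ) r := by
      rw [hs.le_iff_le, hs.le_iff_le, Finset.mem_Ico, Fin.le_def, Fin.le_def]
      simp [Fin.val_succ]
    simp only [e1, e2, e3, ite_mul, one_mul, zero_mul]
  rw [Finset.sum_congr rfl fun k _ => h1 k,
    Fin.sum_univ_eq_sum_range
      (fun i : ℕ => if i ∈ Finset.Ico (p : ℕ) r then G (i + 1) - G i else 0),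
    ← Finset.sum_filter]
  have h2 : Finset.filter (fun i => i ∈ Finset.Ico (p : ℕ) r) (Finset.range n) =
      Finset.Ico (p : ℕ) r := by
    ext i; simp; omega
  rw [h2, Finset.sum_Ico_sub G (by exact hpr)]
  simp only [hG, Fin.is_lt, dite_true, Fin.eta]

/-- The coefficients of `g` with respect to a finer grid `s`. -/
noncomputable def refineCoeff (g : ElementaryKernel q) {n : ℕ} (s : Fin (n + 1) → ℝ)
    (k : Fin q → Fin n) : ℝ :=
  ∑ j : Fin q → Fin g.m, g.coeff j * ∏ i : Fin q,
    if g.grid (j i).castSucc ≤ s (k i).castSucc ∧ s (k i).succ ≤ g.grid (j i).succ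
      then (1 : ℝ) else 0

/-- A fine interval used twice lies in two coarse intervals, which then overlap and so coincide.
Hence `j` repeats an index too, and its coefficient is zero. -/
theorem refineCoeff_diagonal (g : ElementaryKernel q) {n : ℕ} {s : Fin (n + 1) → ℝ}
    (hs : StrictMono s) (k : Fin q → Fin n) (hk : ¬ Function.Injective k) :
    g.refineCoeff s k = 0 := by
  refine Finset.sum_eq_zero fun j _ => ?_
  by_cases hj : Function.Injective j
  · obtain ⟨i, i', hii, hne⟩ : ∃ i i', k i = k i' ∧ i ≠ i' := by
      simpa [Function.Injective] using hk
    by_contra hc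
    have h0 := Finset.prod_ne_zero_iff.1 (right_ne_zero_of_mul hc)
    have h1 := h0 i (Finset.mem_univ _)
    have h2 := h0 i' (Finset.mem_univ _)
    simp only [ne_eq, ite_eq_right_iff, one_ne_zero, imp_false, not_not] at h1 h2
    rw [← hii] at h2
    have h3 : s (k i).castSucc < s (k i).succ := hs Fin.castSucc_lt_succ
    have h4 := g.grid_strictMono.lt_iff_lt.1 ((h1.1.trans_lt h3).trans_le h2.2)
    have h5 := g.grid_strictMono.lt_iff_lt.1 ((h2.1.trans_lt h3).trans_le h1.2)
    simp only [Fin.castSucc_lt_succ_iff] at h4 h5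
    exact hne (hj (le_antisymm h4 h5))
  · rw [g.coeff_diagonal j hj, zero_mul]

/-- The sum over `k` factors into `q` one-dimensional sums, each telescoping to a coarse increment.
-/
theorem sum_refineCoeff (g : ElementaryKernel q) {n : ℕ} {s : Fin (n + 1) → ℝ}
    (hs : StrictMono s) (hgs : ∀ i, g.grid i ∈ range s) (F : Fin q → ℝ → ℝ) :
    ∑ k : Fin q → Fin n, g.refineCoeff s k *
      ∏ i, (F i (s (k i).succ) - F i (s (k i).castSucc)) = g.eval F := by
  simp only [refineCoeff, eval, Finset.sum_mul]
  rw [Finset.sum_comm]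
  refine Finset.sum_congr rfl fun j _ => ?_
  simp only [mul_assoc, ← Finset.mul_sum, ← Finset.prod_mul_distrib]
  congr 1
  have h := Finset.prod_univ_sum (fun _ : Fin q => (Finset.univ : Finset (Fin n)))
    (fun i k => (if g.grid (j i).castSucc ≤ s k.castSucc ∧ s k.succ ≤ g.grid (j i).succ
      then (1 : ℝ) else 0) * (F i (s k.succ) - F i (s k.castSucc)))
  rw [Fintype.piFinset_univ] at h
  rw [← h]
  refine Finset.prod_congr rfl fun i _ => ?_
  obtain ⟨p, hp⟩ := hgs (j i).castSucc
  obtain ⟨r, hr⟩ := hgs (j i).succ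
  rw [← hp, ← hr]
  refine sum_sub_of_grid hs (F i) (hs.le_iff_le.1 ?_)
  rw [hp, hr]
  exact (g.grid_strictMono Fin.castSucc_lt_succ).le

/-- Elementary kernels are closed under differences, by passing to a common refinement. -/
theorem exists_sub (g h : ElementaryKernel q) :
    ∃ k : ElementaryKernel q, ∀ F, k.eval F = g.eval F - h.eval F := by
  classical
  set S : Finset ℝ := Finset.univ.image g.grid ∪ Finset.univ.image h.grid with hS
  have hpos : 0 < S.card := Finset.card_pos.2 ⟨g.grid 0, by simp [hS]⟩
  obtain ⟨n, hn⟩ : ∃ n, S.card = n + 1 := ⟨S.card - 1, by omega⟩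
  have hs : StrictMono (S.orderEmbOfFin hn) := (S.orderEmbOfFin hn).strictMono
  refine ⟨⟨n, S.orderEmbOfFin hn, hs, fun k => g.refineCoeff (S.orderEmbOfFin hn) k -
    h.refineCoeff (S.orderEmbOfFin hn) k, fun k hk => ?_⟩, fun F => ?_⟩
  · rw [g.refineCoeff_diagonal hs k hk, h.refineCoeff_diagonal hs k hk, sub_zero]
  · rw [← g.sum_refineCoeff hs (fun i => ?_) F, ← h.sum_refineCoeff hs (fun i => ?_) F,
      ← Finset.sum_sub_distrib]
    · exact Finset.sum_congr rfl fun k _ => sub_mul _ _ _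
    · simp [hS]
    · simp [hS]

end ElementaryKernel

/-! ### Second moments of off-diagonal forms in independent variables -/

theorem eLpNorm_two_sq {α : Type*} [MeasurableSpace α] {μ : Measure α} {f : α → ℝ}
    (hf : MemLp f 2 μ) : eLpNorm f 2 μ ^ 2 = ENNReal.ofReal (∫ x, f x ^ 2 ∂μ) := by
  have h0 : 0 ≤ ∫ x, f x ^ 2 ∂μ := integral_nonneg fun x => sq_nonneg _
  rw [hf.eLpNorm_eq_integral_rpow_norm two_ne_zero ENNReal.ofNat_ne_top,
    ← ENNReal.ofReal_pow (Real.rpow_nonneg (integral_nonneg fun x => by positivity) _)]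
  congr 1
  simp only [ENNReal.toReal_ofNat, Real.rpow_ofNat, Real.norm_eq_abs, sq_abs]
  rw [← Real.rpow_natCast, ← Real.rpow_mul h0]
  norm_num

section Independent

variable {Ω : Type*} [MeasurableSpace Ω] {P : Measure Ω} {q m : ℕ} {X : Fin m → Ω → ℝ}
  {v : Fin m → ℝ}

theorem prod_comp_eq_prod_pow {q m : ℕ} {j : Fin q → Fin m} (hj : Function.Injective j)
    (x : Fin m → ℝ) :
    ∏ i, x (j i) = ∏ k, x k ^ (if k ∈ Finset.univ.image j then 1 else 0) := by
  simp only [pow_ite, pow_one, pow_zero]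
  rw [Finset.prod_ite_mem, Finset.univ_inter, Finset.prod_image (hj.injOn)]

/-- Each variable occurs with exponent 0, 1 or 2, and the expectation factors. If the index sets
differ, some exponent is exactly 1 and the zero mean kills the product. -/
theorem integral_prod_mul_prod_of_iIndepFun (hX : iIndepFun X P) (hm : ∀ k, AEMeasurable (X k) P)
    (h1 : ∀ k, ∫ ω, X k ω ∂P = 0) (h2 : ∀ k, ∫ ω, X k ω ^ 2 ∂P = v k)
    {j l : Fin q → Fin m} (hj : Function.Injective j) (hl : Function.Injective l) :
    ∫ ω, (∏ i, X (j i) ω) * ∏ i, X (l i) ω ∂P =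
      if Finset.univ.image j = Finset.univ.image l then ∏ i, v (j i) else 0 := by
  have := hX.isProbabilityMeasure
  have e : ∀ ω, (∏ i, X (j i) ω) * ∏ i, X (l i) ω =
      ∏ k, (fun x : ℝ => x ^ ((if k ∈ Finset.univ.image j then 1 else 0) +
        if k ∈ Finset.univ.image l then 1 else 0)) (X k ω) := fun ω => by
    rw [prod_comp_eq_prod_pow hj fun k => X k ω, prod_comp_eq_prod_pow hl fun k => X k ω,
      ← Finset.prod_mul_distrib]
    simp only [pow_add]
  rw [integral_congr_ae (.of_forall e), hX.integral_fun_prod_comp hm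
    fun k => (continuous_pow _).aestronglyMeasurable]
  split_ifs with h
  · rw [prod_comp_eq_prod_pow hj]
    refine Finset.prod_congr rfl fun k _ => ?_
    rw [← h]
    split_ifs <;> simp [h2]
  · obtain ⟨k, hk⟩ : ∃ k, ¬ (k ∈ Finset.univ.image j ↔ k ∈ Finset.univ.image l) := by
      by_contra! hc
      exact h (Finset.ext hc)
    refine Finset.prod_eq_zero (Finset.mem_univ k) ?_
    split_ifs with h3 h4 h4
    · exact absurd (iff_of_true h3 h4) hk
    · simpa using h1 k
    · simpa using h1 k
    · exact absurd (iff_of_false h3 h4) hk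

/-- Hölder with `q` exponents equal to `2q`. -/
theorem memLp_two_prod (hX : ∀ k, ∀ p : ℝ≥0∞, p ≠ ∞ → MemLp (X k) p P) [IsProbabilityMeasure P]
    (j : Fin q → Fin m) : MemLp (fun ω => ∏ i, X (j i) ω) 2 P := by
  refine (MemLp.prod' (s := Finset.univ) (p := fun _ => 2 * (q : ℝ≥0∞)) fun i _ =>
    hX (j i) _ (ENNReal.mul_ne_top (by simp) (by simp))).mono_exponent ?_
  rw [ENNReal.le_inv_iff_le_inv]
  simp only [Finset.sum_const, Finset.card_univ, Fintype.card_fin, nsmul_eq_mul]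
  rcases Nat.eq_zero_or_pos q with rfl | hq
  · simp
  · rw [ENNReal.mul_inv (by simp) (by simp), mul_left_comm, ENNReal.mul_inv_cancel (by simp; omega)
      (by simp), mul_one]

/-- Only pairs `j, l` with the same image contribute. The inequality `2 c_j c_l ≤ c_j² + c_l²`
reduces them to squares, and at most `q^q` tuples `l` take values in the image of `j`; this crude
count replaces `q!`. -/
theorem integral_sum_prod_sq_le [IsProbabilityMeasure P] (hX : iIndepFun X P)
    (hp : ∀ k, ∀ p : ℝ≥0∞, p ≠ ∞ → MemLp (X k) p P)
    (h1 : ∀ k, ∫ ω, X k ω ∂P = 0) (h2 : ∀ k, ∫ ω, X k ω ^ 2 ∂P = v k)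
    {c : (Fin q → Fin m) → ℝ} (hc : ∀ j, ¬ Function.Injective j → c j = 0) :
    ∫ ω, (∑ j, c j * ∏ i, X (j i) ω) ^ 2 ∂P ≤ q ^ q * ∑ j, c j ^ 2 * ∏ i, v (j i) := by
  have hv : ∀ k, 0 ≤ v k := fun k => h2 k ▸ integral_nonneg fun ω => sq_nonneg _
  have hw : ∀ j : Fin q → Fin m, 0 ≤ ∏ i, v (j i) := fun j => Finset.prod_nonneg fun i _ => hv _
  have hi : ∀ j l : Fin q → Fin m,
      Integrable (fun ω => c j * c l * ((∏ i, X (j i) ω) * ∏ i, X (l i) ω)) P := fun j l =>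
    ((memLp_two_prod hp j).integrable_mul (memLp_two_prod hp l)).const_mul _
  have e : ∀ ω, (∑ j, c j * ∏ i, X (j i) ω) ^ 2 =
      ∑ j, ∑ l, c j * c l * ((∏ i, X (j i) ω) * ∏ i, X (l i) ω) := fun ω => by
    rw [sq, Finset.sum_mul_sum]
    exact Finset.sum_congr rfl fun j _ => Finset.sum_congr rfl fun l _ => by ring
  simp only [e]
  rw [integral_finsetSum _ fun j _ => integrable_finsetSum _ fun l _ => hi j l]
  simp only [integral_finsetSum _ fun l _ => hi _ l, integral_const_mul]
  set E : (Fin q → Fin m) → (Fin q → Fin m) → ℝ := fun j l =>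
    if Finset.univ.image j = Finset.univ.image l then c j ^ 2 * ∏ i, v (j i) else 0 with hE
  have key : ∀ j l, c j * c l * ∫ ω, (∏ i, X (j i) ω) * ∏ i, X (l i) ω ∂P ≤
      (E j l + E l j) / 2 := by
    intro j l
    have hE0 : ∀ j l, 0 ≤ E j l := fun j l => by
      simp only [hE]; split_ifs
      · exact mul_nonneg (sq_nonneg _) (hw j)
      · exact le_rfl
    by_cases hj : Function.Injective j
    · by_cases hl : Function.Injective l
      · rw [integral_prod_mul_prod_of_iIndepFun hX
          (fun k => (hp k 1 ENNReal.one_ne_top).1.aemeasurable) h1 h2 hj hl]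
        simp only [hE]
        by_cases h : Finset.univ.image j = Finset.univ.image l
        · have hw' : ∏ i, v (l i) = ∏ i, v (j i) := by
            rw [prod_comp_eq_prod_pow hj, prod_comp_eq_prod_pow hl, h]
          rw [if_pos h, if_pos h, if_pos h.symm, hw']
          nlinarith [mul_nonneg (sq_nonneg (c j - c l)) (hw j)]
        · rw [if_neg h, if_neg h, if_neg (Ne.symm h)]
          simp
      · rw [hc l hl]; nlinarith [hE0 j l, hE0 l j]
    · rw [hc j hj]; nlinarith [hE0 j l, hE0 l j]
  refine (Finset.sum_le_sum fun j _ => Finset.sum_le_sum fun l _ => key j l).trans ?_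
  have hsym : ∑ j, ∑ l, (E j l + E l j) / 2 = ∑ j, ∑ l, E j l := by
    simp only [← Finset.sum_div, Finset.sum_add_distrib]
    rw [Finset.sum_comm (f := fun j l => E l j)]
    ring
  rw [hsym, Finset.mul_sum]
  refine Finset.sum_le_sum fun j _ => ?_
  simp only [hE]
  rw [← Finset.sum_filter, Finset.sum_const, nsmul_eq_mul]
  refine mul_le_mul_of_nonneg_right ?_ (mul_nonneg (sq_nonneg _) (hw j))
  have hsub : Finset.univ.filter (fun l : Fin q → Fin m =>
      Finset.univ.image j = Finset.univ.image l) ⊆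
      Fintype.piFinset fun _ : Fin q => Finset.univ.image j := by
    intro l hl
    rw [Finset.mem_filter] at hl
    rw [Fintype.mem_piFinset, hl.2]
    exact fun i => Finset.mem_image_of_mem _ (Finset.mem_univ i)
  have hcard := Finset.card_le_card hsub
  rw [Fintype.card_piFinset_const] at hcard
  have h3 : (Finset.univ.image j).card ≤ q := Finset.card_image_le.trans (by simp)
  exact_mod_cast hcard.trans (Nat.pow_le_pow_left h3 q)

end Independent

/-! ### Brownian increments and the bound for elementary integrals -/

namespace IsTwoSidedBrownianMotion

variable {Ω : Type*} [MeasurableSpace Ω] {P : Measure Ω} {B : ℝ → Ω → ℝ}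

theorem memLp_sub
    (hB : IsTwoSidedBrownianMotion B P) {s t : ℝ} (h : s ≤ t) {p : ℝ≥0∞} (hp : p ≠ ∞) :
    MemLp (fun ω => B t ω - B s ω) p P := by
  have hl := hB.law_increments s t h
  have := memLp_id_gaussianReal' (μ := 0) (v := (t - s).toNNReal) p hp
  rw [← hl.map_eq] at this
  exact (memLp_map_measure_iff aestronglyMeasurable_id hl.aemeasurable).1 this

theorem integral_sub
    (hB : IsTwoSidedBrownianMotion B P) {s t : ℝ} (h : s ≤ t) :
    ∫ ω, (B t ω - B s ω) ∂P = 0 := by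
  rw [(hB.law_increments s t h).integral_eq, integral_id_gaussianReal]

theorem integral_sub_sq
    (hB : IsTwoSidedBrownianMotion B P) {s t : ℝ} (h : s ≤ t) :
    ∫ ω, (B t ω - B s ω) ^ 2 ∂P = t - s := by
  have hv := (hB.law_increments s t h).variance_eq
  rw [variance_id_gaussianReal, variance_of_integral_eq_zero
    (hB.law_increments s t h).aemeasurable (hB.integral_sub h)] at hv
  rw [hv, Real.coe_toNNReal _ (sub_nonneg.2 h)]

end IsTwoSidedBrownianMotion

namespace ElementaryKernel

variable {q : ℕ}

/-- The boxes of a grid are pairwise disjoint, so the cross terms vanish. -/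
theorem toFun_sq (g : ElementaryKernel q) (y : Fin q → ℝ) :
    g.toFun y ^ 2 = ∑ j, g.coeff j ^ 2 * ∏ i : Fin q,
      (Ioc (g.grid (j i).castSucc) (g.grid (j i).succ)).indicator (fun _ => (1 : ℝ)) (y i) := by
  rw [toFun, sq, Finset.sum_mul_sum]
  refine Finset.sum_congr rfl fun j _ => ?_
  rw [Finset.sum_eq_single j]
  · rw [mul_mul_mul_comm, ← sq, ← Finset.prod_mul_distrib]
    congr 1
    refine Finset.prod_congr rfl fun i _ => ?_
    simp only [indicator]; split_ifs <;> simp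
  · intro l _ hl
    obtain ⟨i, hi⟩ := Function.ne_iff.1 hl
    rw [mul_mul_mul_comm, ← Finset.prod_mul_distrib]
    refine mul_eq_zero_of_right _ (Finset.prod_eq_zero (Finset.mem_univ i) ?_)
    by_contra h
    have h1 := mem_of_indicator_ne_zero (left_ne_zero_of_mul h)
    have h2 := mem_of_indicator_ne_zero (right_ne_zero_of_mul h)
    have h4 := g.grid_strictMono.lt_iff_lt.1 (h1.1.trans_le h2.2)
    have h5 := g.grid_strictMono.lt_iff_lt.1 (h2.1.trans_le h1.2)
    simp only [Fin.castSucc_lt_succ_iff] at h4 h5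
    exact hi (le_antisymm h5 h4)
  · simp

theorem measurable_toFun (g : ElementaryKernel q) : Measurable g.toFun := by
  unfold toFun
  refine Finset.measurable_fun_sum _ fun j _ =>
    (Finset.measurable_fun_prod _ fun i _ => ?_).const_mul _
  exact (measurable_const.indicator measurableSet_Ioc).comp (measurable_pi_apply i)

theorem integrable_prod_indicator (g : ElementaryKernel q) (j : Fin q → Fin g.m) :
    Integrable fun y : Fin q → ℝ => ∏ i : Fin q,
      (Ioc (g.grid (j i).castSucc) (g.grid (j i).succ)).indicator (fun _ => (1 : ℝ)) (y i) := by
  refine Integrable.fintype_prod (μ := fun _ => (volume : Measure ℝ)) fun i => ?_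
  exact (integrable_indicator_iff measurableSet_Ioc).2 (integrableOn_const (by simp))

theorem memLp_toFun (g : ElementaryKernel q) : MemLp g.toFun 2 volume := by
  rw [memLp_two_iff_integrable_sq g.measurable_toFun.aestronglyMeasurable]
  simp only [toFun_sq]
  exact integrable_finsetSum _ fun j _ => (g.integrable_prod_indicator j).const_mul _

theorem integral_toFun_sq (g : ElementaryKernel q) :
    ∫ y, g.toFun y ^ 2 =
      ∑ j, g.coeff j ^ 2 * ∏ i : Fin q, (g.grid (j i).succ - g.grid (j i).castSucc) := by
  simp only [toFun_sq]
  rw [integral_finsetSum _ fun j _ => (g.integrable_prod_indicator j).const_mul _]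
  refine Finset.sum_congr rfl fun j _ => ?_
  rw [integral_const_mul, integral_fintype_prod_volume_eq_prod (fun i (x : ℝ) =>
    (Ioc (g.grid (j i).castSucc) (g.grid (j i).succ)).indicator (fun _ => (1 : ℝ)) x)]
  congr 1
  refine Finset.prod_congr rfl fun i _ => ?_
  rw [integral_indicator measurableSet_Ioc]
  simp [(g.grid_strictMono Fin.castSucc_lt_succ).le]

variable {Ω : Type*} [MeasurableSpace Ω] {P : Measure Ω} [IsProbabilityMeasure P]
  {B : ℝ → Ω → ℝ}

theorem memLp_integral (g : ElementaryKernel q) (hB : IsTwoSidedBrownianMotion B P) :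
    MemLp (g.integral B) 2 P := by
  unfold integral
  refine memLp_finsetSum _ fun j _ => MemLp.const_mul ?_ _
  exact memLp_two_prod (X := fun (k : Fin g.m) ω => B (g.grid k.succ) ω - B (g.grid k.castSucc) ω)
    (fun k p hp => hB.memLp_sub (g.grid_strictMono Fin.castSucc_lt_succ).le hp) j

theorem integral_integral_sq_le (g : ElementaryKernel q) (hB : IsTwoSidedBrownianMotion B P) :
    ∫ ω, g.integral B ω ^ 2 ∂P ≤ q ^ q * ∫ y, g.toFun y ^ 2 := by
  have hle : ∀ k : Fin g.m, g.grid k.castSucc ≤ g.grid k.succ := fun k =>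
    (g.grid_strictMono Fin.castSucc_lt_succ).le
  rw [integral_toFun_sq]
  exact integral_sum_prod_sq_le (hB.indep_increments g.m g.grid g.grid_strictMono.monotone)
    (fun k p hp => hB.memLp_sub (hle k) hp) (fun k => hB.integral_sub (hle k))
    (fun k => hB.integral_sub_sq (hle k)) g.coeff_diagonal

theorem eLpNorm_integral_le (g : ElementaryKernel q) (hB : IsTwoSidedBrownianMotion B P) :
    eLpNorm (g.integral B) 2 P ≤ (q : ℝ≥0∞) ^ q * eLpNorm g.toFun 2 volume := by
  -- This allows `q^q` in place of its square root; for `q = 0` it reads `0^0 = 1`.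
  have hq : (1 : ℝ) ≤ (q : ℝ) ^ q := mod_cast Nat.pow_self_pos
  have h0 : 0 ≤ ∫ y, g.toFun y ^ 2 := integral_nonneg fun y => sq_nonneg _
  rw [← ENNReal.pow_le_pow_left_iff two_ne_zero, mul_pow, eLpNorm_two_sq (g.memLp_integral hB),
    eLpNorm_two_sq g.memLp_toFun, ← ENNReal.ofReal_natCast q, ← ENNReal.ofReal_pow (by positivity),
    ← ENNReal.ofReal_pow (by positivity), ← ENNReal.ofReal_mul (by positivity)]
  refine ENNReal.ofReal_le_ofReal ((g.integral_integral_sq_le hB).trans ?_)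
  exact mul_le_mul_of_nonneg_right (by nlinarith) h0

theorem eLpNorm_integral_sub_le (g h : ElementaryKernel q)
    (hB : IsTwoSidedBrownianMotion B P) :
    eLpNorm (g.integral B - h.integral B) 2 P ≤
      (q : ℝ≥0∞) ^ q * eLpNorm (g.toFun - h.toFun) 2 volume := by
  obtain ⟨k, hk⟩ := exists_sub g h
  have e1 : k.integral B = g.integral B - h.integral B := funext fun ω => by
    simp only [Pi.sub_apply, integral_eq_eval, hk]
  have e2 : k.toFun = g.toFun - h.toFun := funext fun y => by
    simp only [Pi.sub_apply, toFun_eq_eval, hk]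
  rw [← e1, ← e2]
  exact k.eLpNorm_integral_le hB

end ElementaryKernel

/-! ### Density of elementary kernels in `L²(ℝ^q)` -/

theorem eLpNorm_two_sq_eq_lintegral {α : Type*} [MeasurableSpace α] {μ : Measure α} (f : α → ℝ) :
    eLpNorm f 2 μ ^ 2 = ∫⁻ x, ‖f x‖ₑ ^ 2 ∂μ := by
  have h := eLpNorm_nnreal_pow_eq_lintegral (μ := μ) (f := f) (p := 2) two_ne_zero
  simpa using h

namespace ElementaryKernel

variable {q : ℕ}

theorem toFun_of_mem (g : ElementaryKernel q) {y : Fin q → ℝ} {j : Fin q → Fin g.m}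
    (h : ∀ i, y i ∈ Ioc (g.grid (j i).castSucc) (g.grid (j i).succ)) :
    g.toFun y = g.coeff j := by
  rw [toFun, Finset.sum_eq_single j]
  · rw [Finset.prod_eq_one fun i _ => indicator_of_mem (h i) _, mul_one]
  · intro l _ hl
    obtain ⟨i, hi⟩ := Function.ne_iff.1 hl
    refine mul_eq_zero_of_right _ (Finset.prod_eq_zero (Finset.mem_univ i)
      (indicator_of_notMem (fun h2 => hi ?_) _))
    have h4 := g.grid_strictMono.lt_iff_lt.1 ((h i).1.trans_le h2.2)
    have h5 := g.grid_strictMono.lt_iff_lt.1 (h2.1.trans_le (h i).2)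
    simp only [Fin.castSucc_lt_succ_iff] at h4 h5
    exact le_antisymm h5 h4
  · simp

theorem exists_mem_of_toFun_ne_zero (g : ElementaryKernel q) {y : Fin q → ℝ} (h : g.toFun y ≠ 0) :
    ∃ j, (∀ i, y i ∈ Ioc (g.grid (j i).castSucc) (g.grid (j i).succ)) ∧ g.coeff j ≠ 0 := by
  obtain ⟨j, _, hj⟩ := Finset.exists_ne_zero_of_sum_ne_zero h
  exact ⟨j, fun i => mem_of_indicator_ne_zero
    (Finset.prod_ne_zero_iff.1 (right_ne_zero_of_mul hj) i (Finset.mem_univ i)),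
    left_ne_zero_of_mul hj⟩

open Classical in
/-- The step function that samples `ψ` on the grid of mesh `1 / n` in `[-n, n]^q`, off the
diagonals. -/
noncomputable def sample (ψ : (Fin q → ℝ) → ℝ) (n : ℕ) (hn : 0 < n) : ElementaryKernel q where
  m := 2 * n * n
  grid k := -n + (k : ℕ) / (n : ℝ)
  grid_strictMono k l h := by
    have : (0 : ℝ) < n := mod_cast hn
    have h' : ((k : ℕ) : ℝ) < (l : ℕ) := mod_cast h
    simp only [add_lt_add_iff_left]
    gcongr
  coeff j := if Function.Injective j then ψ fun i => -n + (((j i : ℕ) : ℝ) + 1) / (n : ℝ) else 0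
  coeff_diagonal j hj := if_neg hj

theorem exists_mem_sample_box (ψ : (Fin q → ℝ) → ℝ) {n : ℕ} (hn : 0 < n) {x : ℝ}
    (h1 : -(n : ℝ) < x) (h2 : x ≤ n) : ∃ k : Fin (sample ψ n hn).m,
    x ∈ Ioc ((sample ψ n hn).grid k.castSucc) ((sample ψ n hn).grid k.succ) := by
  have hn' : (0 : ℝ) < n := mod_cast hn
  have hx : 0 < (x + n) * n := mul_pos (by linarith) hn'
  -- Intervals are closed on the right, so the index is the ceiling minus one; `x > -n` keeps the
  -- subtraction from truncating.
  have hc : 0 < ⌈(x + n) * n⌉₊ := Nat.ceil_pos.2 hx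
  have hc2 : ⌈(x + n) * n⌉₊ ≤ 2 * n * n := by
    refine Nat.ceil_le.2 ?_
    push_cast
    exact mul_le_mul_of_nonneg_right (by linarith) hn'.le
  have hlt : ⌈(x + n) * n⌉₊ - 1 < 2 * n * n := by omega
  refine ⟨⟨⌈(x + n) * n⌉₊ - 1, hlt⟩, ?_, ?_⟩
  · have : ((⌈(x + n) * n⌉₊ - 1 : ℕ) : ℝ) < (x + n) * n := by
      rw [Nat.cast_sub hc]
      have := Nat.ceil_lt_add_one hx.le
      push_cast; linarith
    have h3 := (div_lt_iff₀ hn').2 this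
    simp only [sample, Fin.val_castSucc]
    linarith
  · have := (le_div_iff₀ hn').2 (Nat.le_ceil ((x + n) * n))
    simp only [sample, Fin.val_succ, Nat.sub_add_cancel hc]
    linarith

theorem sample_box_bounds (ψ : (Fin q → ℝ) → ℝ) {n : ℕ} (hn : 0 < n) {y : Fin q → ℝ}
    {j : Fin q → Fin (sample ψ n hn).m}
    (h : ∀ i, y i ∈ Ioc ((sample ψ n hn).grid (j i).castSucc) ((sample ψ n hn).grid (j i).succ))
    (i : Fin q) : -n + (((j i : ℕ) : ℝ) + 1) / (n : ℝ) - 1 / n < y i ∧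
      y i ≤ -n + (((j i : ℕ) : ℝ) + 1) / (n : ℝ) := by
  obtain ⟨h1, h2⟩ : -(n : ℝ) + ((j i : ℕ) : ℝ) / n < y i ∧
    y i ≤ -(n : ℝ) + (((j i : ℕ) + 1 : ℕ) : ℝ) / n := h i
  push_cast at h2
  refine ⟨?_, h2⟩
  rw [add_div]
  linarith

theorem dist_sample_point_le (ψ : (Fin q → ℝ) → ℝ) {n : ℕ} (hn : 0 < n) {y : Fin q → ℝ}
    {j : Fin q → Fin (sample ψ n hn).m}
    (h : ∀ i, y i ∈ Ioc ((sample ψ n hn).grid (j i).castSucc) ((sample ψ n hn).grid (j i).succ)) :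
    dist (fun i => -n + (((j i : ℕ) : ℝ) + 1) / (n : ℝ)) y ≤ 1 / n := by
  refine (dist_pi_le_iff (by positivity)).2 fun i => ?_
  have := sample_box_bounds ψ hn h i
  rw [Real.dist_eq, abs_le]
  constructor <;> linarith [show (0 : ℝ) ≤ 1 / n by positivity]

/-- Once the mesh is below every gap between coordinates of `y`, these lie in distinct intervals, so
the zero coefficients on the diagonals do not interfere and continuity of `ψ` finishes. -/
theorem tendsto_toFun_sample {ψ : (Fin q → ℝ) → ℝ} (hψ : Continuous ψ) {y : Fin q → ℝ}
    (hy : Function.Injective y) :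
    Tendsto (fun n : ℕ => (sample ψ (n + 1) n.succ_pos).toFun y) atTop (𝓝 (ψ y)) := by
  rw [Metric.tendsto_nhds]
  intro ε hε
  obtain ⟨δ, hδ, hψδ⟩ := Metric.continuous_iff.1 hψ y ε hε
  have hz : Tendsto (fun n : ℕ => 1 / ((n + 1 : ℕ) : ℝ)) atTop (𝓝 0) := by
    simpa using tendsto_one_div_add_atTop_nhds_zero_nat (𝕜 := ℝ)
  have hb : ∀ᶠ n : ℕ in atTop, ∀ i, -((n + 1 : ℕ) : ℝ) < y i ∧ y i ≤ (n + 1 : ℕ) := by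
    refine eventually_all.2 fun i => ?_
    filter_upwards [eventually_ge_atTop ⌈|y i|⌉₊] with n hn
    have h1 : |y i| ≤ n := (Nat.le_ceil _).trans (mod_cast hn)
    rw [abs_le] at h1
    push_cast
    constructor <;> linarith
  have hs : ∀ᶠ n : ℕ in atTop, ∀ i i', i ≠ i' → 1 / ((n + 1 : ℕ) : ℝ) < |y i - y i'| := by
    refine eventually_all.2 fun i => eventually_all.2 fun i' => ?_
    by_cases h : i = i'
    · exact .of_forall fun n hn => absurd h hn
    · filter_upwards [hz.eventually (gt_mem_nhds (abs_pos.2 (sub_ne_zero.2 (hy.ne h))))]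
        with n hn _ using hn
  filter_upwards [hb, hs, hz.eventually (gt_mem_nhds hδ)] with n h1 h2 h3
  choose j hj using fun i => exists_mem_sample_box ψ n.succ_pos (h1 i).1 (h1 i).2
  rw [toFun_of_mem _ hj]
  have hinj : Function.Injective j := fun i i' hii => by
    by_contra hne
    have h4 := sample_box_bounds ψ n.succ_pos hj i
    have h5 := sample_box_bounds ψ n.succ_pos hj i'
    rw [← hii] at h5
    have h6 := h2 i i' hne
    rw [lt_abs] at h6
    simp only [Nat.succ_eq_add_one] at h4 h5
    rcases h6 with h6 | h6 <;> linarith [h4.1, h4.2, h5.1, h5.2]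
  have hc : (sample ψ (n + 1) n.succ_pos).coeff j =
      ψ fun i => -((n + 1 : ℕ) : ℝ) + (((j i : ℕ) : ℝ) + 1) / ((n + 1 : ℕ) : ℝ) := if_pos hinj
  rw [hc]
  exact hψδ _ ((dist_sample_point_le ψ n.succ_pos hj).trans_lt h3)

/-- The sampled point is within distance 1 of `y`, whence the radius `R + 1`. This is the domination
for the `L²` convergence. -/
theorem abs_toFun_sample_le {ψ : (Fin q → ℝ) → ℝ} {C R : ℝ} (hC : ∀ x, |ψ x| ≤ C)
    (hR : ∀ x, ψ x ≠ 0 → x ∈ Metric.closedBall 0 R) (n : ℕ) (y : Fin q → ℝ) :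
    |(sample ψ (n + 1) n.succ_pos).toFun y| ≤
      (Metric.closedBall (0 : Fin q → ℝ) (R + 1)).indicator (fun _ => C) y := by
  have hC0 : 0 ≤ C := (abs_nonneg _).trans (hC 0)
  by_cases h : (sample ψ (n + 1) n.succ_pos).toFun y = 0
  · rw [h, abs_zero]
    exact indicator_nonneg (fun _ _ => hC0) _
  · obtain ⟨j, hj, hj0⟩ := exists_mem_of_toFun_ne_zero _ h
    have hd := dist_sample_point_le ψ n.succ_pos hj
    rw [toFun_of_mem _ hj]
    have hinj : Function.Injective j := by
      by_contra hc; exact hj0 (if_neg hc)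
    have hc : (sample ψ (n + 1) n.succ_pos).coeff j =
      ψ fun i => -((n + 1 : ℕ) : ℝ) + (((j i : ℕ) : ℝ) + 1) / ((n + 1 : ℕ) : ℝ) := if_pos hinj
    rw [hc] at hj0 ⊢
    rw [indicator_of_mem]
    · exact hC _
    · have h1 := hR _ hj0
      rw [Metric.mem_closedBall] at h1 ⊢
      have h2 : (1 : ℝ) / ((n + 1 : ℕ) : ℝ) ≤ 1 := by
        rw [div_le_one (by positivity)]; push_cast; linarith [(n.cast_nonneg : (0 : ℝ) ≤ n)]
      rw [dist_comm] at hd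
      exact (dist_triangle _ _ _).trans (by linarith)

end ElementaryKernel

/-- Each diagonal is a proper linear subspace, hence null. -/
theorem ae_injective (q : ℕ) : ∀ᵐ y : Fin q → ℝ, Function.Injective y := by
  have h : ∀ i i' : Fin q, i ≠ i' → ∀ᵐ y : Fin q → ℝ, y i ≠ y i' := by
    intro i i' hii
    let S : Submodule ℝ (Fin q → ℝ) := LinearMap.ker
      ((LinearMap.proj i : (Fin q → ℝ) →ₗ[ℝ] ℝ) - LinearMap.proj i')
    have hS : S ≠ ⊤ := fun h => by
      have h1 : Pi.single i (1 : ℝ) ∈ S := h ▸ Submodule.mem_top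
      simp [S, hii.symm] at h1
    have := Measure.addHaar_submodule (volume : Measure (Fin q → ℝ)) S hS
    refine measure_mono_null (fun y hy => ?_) this
    simp only [mem_compl_iff, mem_ofPred_eq, ne_eq, not_not] at hy
    simp [S, hy]
  have h' : ∀ᵐ y : Fin q → ℝ, ∀ i i' : Fin q, i ≠ i' → y i ≠ y i' := by
    refine ae_all_iff.2 fun i => ae_all_iff.2 fun i' => ?_
    by_cases hii : i = i'
    · exact .of_forall fun y hn => absurd hii hn
    · filter_upwards [h i i' hii] with y hy _ using hy
  filter_upwards [h'] with y hy i i' hii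
  by_contra hne
  exact hy i i' hne hii

theorem tendsto_eLpNorm_sample_sub {q : ℕ} {ψ : (Fin q → ℝ) → ℝ} (hψ : Continuous ψ)
    (hs : HasCompactSupport ψ) :
    Tendsto (fun n : ℕ => eLpNorm
      ((ElementaryKernel.sample ψ (n + 1) n.succ_pos).toFun - ψ) 2 volume) atTop (𝓝 0) := by
  obtain ⟨C, hC⟩ := hs.exists_bound_of_continuous hψ
  obtain ⟨R, hR⟩ := hs.isCompact.isBounded.subset_closedBall 0
  have hR' : ∀ x, ψ x ≠ 0 → x ∈ Metric.closedBall 0 R := fun x hx => hR (subset_tsupport ψ hx)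
  have hC0 : 0 ≤ C := (norm_nonneg _).trans (hC 0)
  set D : (Fin q → ℝ) → ℝ := (Metric.closedBall (0 : Fin q → ℝ) (R + 1)).indicator fun _ => C
  have hψD : ∀ y, |ψ y| ≤ D y := fun y => by
    by_cases h : ψ y = 0
    · rw [h, abs_zero]; exact indicator_nonneg (fun _ _ => hC0) _
    · have : y ∈ Metric.closedBall (0 : Fin q → ℝ) (R + 1) :=
        Metric.closedBall_subset_closedBall (by linarith) (hR' y h)
      simp only [D, indicator_of_mem this]
      exact hC y
  have hlim : Tendsto (fun n : ℕ => ∫⁻ y,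
      ‖((ElementaryKernel.sample ψ (n + 1) n.succ_pos).toFun - ψ) y‖ₑ ^ 2) atTop
      (𝓝 (∫⁻ _ : Fin q → ℝ, 0)) := by
    refine tendsto_lintegral_of_dominated_convergence (fun y => ‖2 * D y‖ₑ ^ 2) (fun n => ?_)
      (fun n => .of_forall fun y => ?_) ?_ ?_
    · exact ((ElementaryKernel.measurable_toFun _).sub hψ.measurable).enorm.pow_const 2
    · refine pow_le_pow_left' ?_ 2
      rw [enorm_le_iff_norm_le, Real.norm_eq_abs, Real.norm_eq_abs, Pi.sub_apply]
      refine (abs_sub _ _).trans (le_trans ?_ (le_abs_self _))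
      have := ElementaryKernel.abs_toFun_sample_le hC hR' n y
      linarith [hψD y]
    · have hD : MemLp (fun y => 2 * D y) 2 volume :=
        (memLp_indicator_const 2 Metric.isClosed_closedBall.measurableSet C
          (Or.inr measure_closedBall_lt_top.ne)).const_mul 2
      rw [← eLpNorm_two_sq_eq_lintegral]
      exact ENNReal.pow_ne_top hD.2.ne
    · filter_upwards [ae_injective q] with y hy
      have h1 := ((ENNReal.continuous_pow 2).tendsto _).comp
        ((ElementaryKernel.tendsto_toFun_sample hψ hy).sub_const (ψ y)).enorm
      simpa [Function.comp_def] using h1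
  rw [lintegral_zero] at hlim
  simp only [← eLpNorm_two_sq_eq_lintegral] at hlim
  have h2 := (ENNReal.continuous_rpow_const (y := 1 / 2)).tendsto 0 |>.comp hlim
  simp only [Function.comp_def, ← ENNReal.rpow_natCast, ← ENNReal.rpow_mul] at h2
  simpa using h2

theorem exists_elementaryKernel_eLpNorm_sub_le {q : ℕ} {f : (Fin q → ℝ) → ℝ}
    (hf : MemLp f 2 volume) {ε : ℝ≥0∞} (hε : ε ≠ 0) :
    ∃ g : ElementaryKernel q, eLpNorm (g.toFun - f) 2 volume ≤ ε := by
  obtain ⟨ψ, hs, hψ, hc, hm⟩ := hf.exists_hasCompactSupport_eLpNorm_sub_le ENNReal.ofNat_ne_top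
    (ENNReal.half_pos hε).ne'
  obtain ⟨n, hn⟩ := ((tendsto_eLpNorm_sample_sub hc hs).eventually
    (gt_mem_nhds (ENNReal.half_pos hε))).exists
  refine ⟨ElementaryKernel.sample ψ (n + 1) n.succ_pos, ?_⟩
  have e : (ElementaryKernel.sample ψ (n + 1) n.succ_pos).toFun - f =
    ((ElementaryKernel.sample ψ (n + 1) n.succ_pos).toFun - ψ) - (f - ψ) := by abel
  rw [e]
  refine (eLpNorm_sub_le (((ElementaryKernel.memLp_toFun _).sub hm).1) (hf.sub hm).1
    one_le_two).trans ?_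
  exact (add_le_add hn.le hψ).trans (ENNReal.add_halves ε).le

/-! ### Existence and `L²` bound of the multiple integral -/

section MultipleIntegral

variable {Ω : Type*} [MeasurableSpace Ω] {P : Measure Ω} [IsProbabilityMeasure P]
  {B : ℝ → Ω → ℝ} {q : ℕ} {f : (Fin q → ℝ) → ℝ}

theorem exists_isMultipleIntegral (hB : IsTwoSidedBrownianMotion B P) (hf : MemLp f 2 volume) :
    ∃ X : Ω → ℝ, IsMultipleIntegral P B f X := by
  choose g hg using fun n : ℕ => exists_elementaryKernel_eLpNorm_sub_le hf
    (ε := 2⁻¹ ^ n) (pow_ne_zero _ (by simp))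
  set K : ℝ≥0∞ := (q : ℝ≥0∞) ^ q with hK
  have hKt : K ≠ ∞ := by simp [hK]
  have h2 : ∀ N n : ℕ, N ≤ n → (2⁻¹ : ℝ≥0∞) ^ n ≤ 2⁻¹ ^ N := fun N n h =>
    pow_le_pow_right_of_le_one' (by simp) h
  -- Two approximants of index at least `N` are within `2 · 2^(-N)`, so their integrals are within
  -- `K · 2 · 2^(-N)`; the extra `1` makes the Cauchy estimate strict.
  have hsum : ∑' N : ℕ, (K * 2 + 1) * (2⁻¹ : ℝ≥0∞) ^ N ≠ ∞ := by
    rw [ENNReal.tsum_mul_left, ENNReal.tsum_geometric]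
    exact ENNReal.mul_ne_top (by finiteness) (by simp)
  have hcau : ∀ N n m : ℕ, N ≤ n → N ≤ m →
      eLpNorm ((g n).integral B - (g m).integral B) 2 P < (K * 2 + 1) * 2⁻¹ ^ N := by
    intro N n m hn hm
    have e : (g n).toFun - (g m).toFun = ((g n).toFun - f) - ((g m).toFun - f) := by abel
    have h3 : eLpNorm ((g n).toFun - (g m).toFun) 2 volume ≤ 2 * 2⁻¹ ^ N := by
      rw [e, two_mul]
      exact (eLpNorm_sub_le (((g n).memLp_toFun.sub hf).1) (((g m).memLp_toFun.sub hf).1)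
        one_le_two).trans (add_le_add ((hg n).trans (h2 N n hn)) ((hg m).trans (h2 N m hm)))
    refine (((g n).eLpNorm_integral_sub_le (g m) hB).trans (mul_le_mul_right h3 K)).trans_lt ?_
    rw [add_mul, one_mul, ← mul_assoc]
    exact ENNReal.lt_add_right (by finiteness) (pow_ne_zero _ (by simp))
  obtain ⟨X, hX, hlim⟩ := Lp.cauchy_complete_eLpNorm (p := 2) (μ := P) one_le_two
    (f := fun n => (g n).integral B) (fun n => (g n).memLp_integral hB)
    hsum hcau
  refine ⟨X, hf, hX, g, ?_, hlim⟩
  exact tendsto_of_tendsto_of_tendsto_of_le_of_le tendsto_const_nhds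
    (ENNReal.tendsto_pow_atTop_nhds_zero_of_lt_one (by simp)) (fun n => zero_le) hg

/-- The bound passes to the limit along any approximating sequence, so it holds for whichever
version is chosen. -/
theorem IsMultipleIntegral.eLpNorm_le (hB : IsTwoSidedBrownianMotion B P) {X : Ω → ℝ}
    (h : IsMultipleIntegral P B f X) :
    eLpNorm X 2 P ≤ (q : ℝ≥0∞) ^ q * eLpNorm f 2 volume := by
  obtain ⟨hf, hX, g, hg, hgX⟩ := h
  set K : ℝ≥0∞ := (q : ℝ≥0∞) ^ q with hK
  have hKt : K ≠ ∞ := by simp [hK]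
  have hlim : Tendsto (fun n => K * (eLpNorm (fun y => (g n).toFun y - f y) 2 volume +
      eLpNorm f 2 volume) + eLpNorm (fun ω => (g n).integral B ω - X ω) 2 P) atTop
      (𝓝 (K * (0 + eLpNorm f 2 volume) + 0)) :=
    (ENNReal.Tendsto.const_mul (hg.add_const _) (Or.inr hKt)).add hgX
  rw [zero_add, add_zero] at hlim
  refine ge_of_tendsto' hlim fun n => ?_
  have e1 : X = (g n).integral B - fun ω => (g n).integral B ω - X ω := by
    ext ω; simp
  have e2 : (g n).toFun = (fun y => (g n).toFun y - f y) + f := by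
    ext y; simp
  calc eLpNorm X 2 P = eLpNorm ((g n).integral B - fun ω => (g n).integral B ω - X ω) 2 P := by
        rw [← e1]
    _ ≤ eLpNorm ((g n).integral B) 2 P + eLpNorm (fun ω => (g n).integral B ω - X ω) 2 P :=
        eLpNorm_sub_le ((g n).memLp_integral hB).1 (((g n).memLp_integral hB).sub hX).1 one_le_two
    _ ≤ _ := by
        gcongr
        refine ((g n).eLpNorm_integral_le hB).trans (mul_le_mul_right ?_ K)
        conv_lhs => rw [e2]
        exact eLpNorm_add_le ((g n).memLp_toFun.sub hf).1 hf.1 one_le_two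

theorem isMultipleIntegral_multipleIntegral (hB : IsTwoSidedBrownianMotion B P)
    (hf : MemLp f 2 volume) : IsMultipleIntegral P B f (multipleIntegral P B f) := by
  have h := exists_isMultipleIntegral hB hf
  rw [multipleIntegral, dif_pos h]
  exact h.choose_spec

theorem integral_multipleIntegral_sq_le (hB : IsTwoSidedBrownianMotion B P)
    (hf : MemLp f 2 volume) {D : ℝ} (hD : 0 ≤ D) (hfD : ∫⁻ y, ‖f y‖ₑ ^ 2 ≤ ENNReal.ofReal D) :
    ∫ ω, multipleIntegral P B f ω ^ 2 ∂P ≤ ((q : ℝ) ^ q) ^ 2 * D := by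
  have h := isMultipleIntegral_multipleIntegral hB hf
  have h1 := pow_le_pow_left' (h.eLpNorm_le hB) 2
  rw [eLpNorm_two_sq h.2.1, mul_pow, eLpNorm_two_sq_eq_lintegral] at h1
  have h2 := h1.trans (mul_le_mul_right hfD _)
  rw [← ENNReal.ofReal_natCast q, ← ENNReal.ofReal_pow (by positivity),
    ← ENNReal.ofReal_pow (by positivity), ← ENNReal.ofReal_mul (by positivity)] at h2
  exact (ENNReal.ofReal_le_ofReal_iff (by positivity)).1 h2

end MultipleIntegral

/-! ### Overlap estimates for the one-dimensional factors -/

theorem lintegral_fin_prod_eq_prod {n : ℕ} {f : Fin n → ℝ → ℝ≥0∞} (hf : ∀ i, Measurable (f i)) :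
    ∫⁻ y : Fin n → ℝ, ∏ i, f i (y i) = ∏ i, ∫⁻ x, f i x := by
  induction n with
  | zero => simp [volume_pi, Measure.pi_empty_univ]
  | succ n ih =>
    rw [Fin.prod_univ_succ, ← ih fun i => hf i.succ, ← lintegral_prod_mul (hf 0).aemeasurable
      (Finset.measurable_fun_prod _ fun i _ =>
        (hf i.succ).comp (measurable_pi_apply i)).aemeasurable]
    rw [← Measure.volume_eq_prod, ← (volume_preserving_piFinSuccAbove (fun _ : Fin (n + 1) => ℝ)
      0).lintegral_comp_emb (MeasurableEquiv.measurableEmbedding _)]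
    simp [Fin.prod_univ_succ, MeasurableEquiv.piFinSuccAbove, Fin.insertNthEquiv, Fin.tail]

theorem setLIntegral_Ioc_rpow {γ d : ℝ} (hγ : -1 < γ) (hd : 0 ≤ d) :
    ∫⁻ x in Ioc 0 d, ENNReal.ofReal (x ^ γ) = ENNReal.ofReal (d ^ (γ + 1) / (γ + 1)) := by
  have hi : IntegrableOn (fun x : ℝ => x ^ γ) (Ioc 0 d) :=
    (intervalIntegrable_iff_integrableOn_Ioc_of_le hd).1
      (intervalIntegral.intervalIntegrable_rpow' hγ)
  rw [← ofReal_integral_eq_lintegral_ofReal hi, ← intervalIntegral.integral_of_le hd,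
    integral_rpow (Or.inl hγ), Real.zero_rpow (by linarith), sub_zero]
  filter_upwards [ae_restrict_mem measurableSet_Ioc] with x hx using Real.rpow_nonneg hx.1.le _

theorem setLIntegral_Ici_rpow {γ c : ℝ} (hγ : γ < -1) (hc : 0 < c) :
    ∫⁻ x in Ici c, ENNReal.ofReal (x ^ γ) = ENNReal.ofReal (-c ^ (γ + 1) / (γ + 1)) := by
  rw [setLIntegral_congr Ioi_ae_eq_Ici.symm, ← ofReal_integral_eq_lintegral_ofReal
    (integrableOn_Ioi_rpow_of_lt hγ hc), integral_Ioi_rpow_of_lt hγ hc]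
  filter_upwards [ae_restrict_mem measurableSet_Ioi] with x hx using
    Real.rpow_nonneg (hc.trans hx).le _

/-- The one-dimensional factor `(u - s)_+^{-β}`. -/
noncomputable def coordKernel (β u s : ℝ) : ℝ≥0∞ :=
  ENNReal.ofReal (if s < u then (u - s) ^ (-β) else 0)

theorem measurable_coordKernel (β : ℝ) : Measurable fun p : ℝ × ℝ => coordKernel β p.1 p.2 := by
  unfold coordKernel
  refine ENNReal.measurable_ofReal.comp (Measurable.ite ?_ ?_ measurable_const)
  · exact measurableSet_lt measurable_snd measurable_fst
  · fun_prop

theorem measurable_coordKernel_right (β u : ℝ) : Measurable (coordKernel β u) :=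
  (measurable_coordKernel β).comp measurable_prodMk_left

theorem coordKernel_mul_le {β b c u v s : ℝ} (hβ : 0 < β) (hc : 0 < c) (hu : b ≤ u) (hv : b ≤ v)
    (hs : c ≤ b - s) :
    coordKernel β u s * coordKernel β v s ≤ ENNReal.ofReal ((b - s) ^ (-2 * β)) := by
  unfold coordKernel
  rw [if_pos (by linarith), if_pos (by linarith),
    ← ENNReal.ofReal_mul (Real.rpow_nonneg (by linarith) _)]
  refine ENNReal.ofReal_le_ofReal ?_
  rw [show -2 * β = -β + -β by ring, Real.rpow_add (by linarith)]
  exact mul_le_mul (Real.rpow_le_rpow_of_nonpos (by linarith) (by linarith) (by linarith))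
    (Real.rpow_le_rpow_of_nonpos (by linarith) (by linarith) (by linarith))
    (Real.rpow_nonneg (by linarith) _) (Real.rpow_nonneg (by linarith) _)

/-- Moving `u` and `v` down to `b` increases both factors; what remains is `∫ x^(-2β)` over `[c,
∞)`, finite as `2β > 1`. -/
theorem setLIntegral_coordKernel_mul_le {β b c u v : ℝ} (hβ : 1 / 2 < β) (hc : 0 < c)
    (hu : b ≤ u) (hv : b ≤ v) :
    ∫⁻ s in Iic (b - c), coordKernel β u s * coordKernel β v s ≤
      ENNReal.ofReal (c ^ (1 - 2 * β) / (2 * β - 1)) := by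
  have h := setLIntegral_Ici_rpow (γ := -2 * β) (by linarith) hc
  rw [← lintegral_indicator measurableSet_Ici, ← lintegral_sub_left_eq_self _ b] at h
  rw [← lintegral_indicator measurableSet_Iic, show c ^ (1 - 2 * β) / (2 * β - 1) =
    -c ^ (-2 * β + 1) / (-2 * β + 1) by
      rw [show -2 * β + 1 = -(2 * β - 1) by ring, neg_div_neg_eq]; congr 2; ring, ← h]
  refine lintegral_mono fun s => ?_
  by_cases hs : s ∈ Iic (b - c)
  · have hs' : b - s ∈ Ici c := by rw [mem_Iic] at hs; rw [mem_Ici]; linarith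
    rw [indicator_of_mem hs, indicator_of_mem hs']
    exact coordKernel_mul_le (by linarith) hc hu hv hs'
  · rw [indicator_of_notMem hs]
    exact zero_le

/-- Let `d = v - u` and split at `s = u - d`. Nearer to `u`, the factor of `v` is at most `d^(-β)`
and the other is integrable as `β < 1`; beyond, the tail bound applies with `b = u`, `c = d`. Both
parts scale as `d^(1 - 2β)`. -/
theorem lintegral_coordKernel_mul_le_of_lt {β u v : ℝ} (hβ : 1 / 2 < β) (hβ' : β < 1)
    (huv : u < v) :
    ∫⁻ s, coordKernel β u s * coordKernel β v s ≤
      ENNReal.ofReal ((1 / (1 - β) + 1 / (2 * β - 1)) * (v - u) ^ (1 - 2 * β)) := by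
  have hd : 0 < v - u := sub_pos.2 huv
  have hfar := setLIntegral_coordKernel_mul_le hβ hd le_rfl huv.le
  have hnear : ∫⁻ s, (Ioc 0 (v - u)).indicator
      (fun x => ENNReal.ofReal (x ^ (-β)) * ENNReal.ofReal ((v - u) ^ (-β))) (u - s) =
      ENNReal.ofReal (1 / (1 - β) * (v - u) ^ (1 - 2 * β)) := by
    rw [lintegral_sub_left_eq_self, lintegral_indicator measurableSet_Ioc,
      lintegral_mul_const _ (by fun_prop), setLIntegral_Ioc_rpow (by linarith) hd.le,
      ← ENNReal.ofReal_mul (div_nonneg (Real.rpow_nonneg hd.le _) (by linarith)),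
      div_mul_eq_mul_div, ← Real.rpow_add hd, div_mul_eq_mul_div, one_mul,
      show -β + 1 = 1 - β by ring,
      show 1 - β + -β = 1 - 2 * β by ring]
  rw [add_mul, ENNReal.ofReal_add (mul_nonneg (div_nonneg zero_le_one (by linarith))
    (Real.rpow_nonneg hd.le _)) (mul_nonneg (div_nonneg zero_le_one (by linarith))
    (Real.rpow_nonneg hd.le _)), ← hnear]
  rw [one_div_mul_eq_div (2 * β - 1)]
  rw [← lintegral_indicator measurableSet_Iic] at hfar
  refine le_trans ?_ (add_le_add le_rfl hfar)
  have hmeas : Measurable fun s => coordKernel β u s * coordKernel β v s :=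
    (measurable_coordKernel_right β u).mul (measurable_coordKernel_right β v)
  rw [← lintegral_add_right _ (hmeas.indicator measurableSet_Iic)]
  refine lintegral_mono fun s => ?_
  by_cases h1 : s < u
  · by_cases h2 : u - s ≤ v - u
    · refine le_add_right ?_
      rw [indicator_of_mem (by rw [mem_Ioc]; exact ⟨by linarith, h2⟩)]
      unfold coordKernel
      rw [if_pos h1, if_pos (h1.trans huv)]
      exact mul_le_mul_right (ENNReal.ofReal_le_ofReal
        (Real.rpow_le_rpow_of_nonpos hd (by linarith) (by linarith))) _
    · refine le_add_left ?_
      rw [indicator_of_mem (by rw [mem_Iic]; linarith)]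
  · simp [coordKernel, h1]

theorem lintegral_coordKernel_mul_le {β u v : ℝ} (hβ : 1 / 2 < β) (hβ' : β < 1) (huv : u ≠ v) :
    ∫⁻ s, coordKernel β u s * coordKernel β v s ≤
      ENNReal.ofReal ((1 / (1 - β) + 1 / (2 * β - 1)) * |u - v| ^ (1 - 2 * β)) := by
  rcases lt_or_gt_of_ne huv with h | h
  · rw [abs_sub_comm, abs_of_pos (sub_pos.2 h)]
    exact lintegral_coordKernel_mul_le_of_lt hβ hβ' h
  · rw [abs_of_pos (sub_pos.2 h)]
    simp only [mul_comm (coordKernel β u _)]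
    exact lintegral_coordKernel_mul_le_of_lt hβ hβ' h

/-- For `M ≥ 1` the tail bound with `c = aM` suffices, since `a ≥ |u - v|` and `M ≥ (M + 1)/2`. For
`M < 1` the full overlap suffices, since `((M + 1)/2)^(1 - 2β) ≥ 1`. The factor `2^(2β - 1)` comes
from this halving. -/
theorem setLIntegral_coordKernel_mul_le_rpow {β a b M u v : ℝ} (hβ : 1 / 2 < β) (hβ' : β < 1)
    (ha : 0 < a) (hM : 0 < M) (hu : u ∈ Ioc b (b + a)) (hv : v ∈ Ioc b (b + a)) (huv : u ≠ v) :
    ∫⁻ s in Iic (b - a * M), coordKernel β u s * coordKernel β v s ≤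
      ENNReal.ofReal ((1 / (1 - β) + 1 / (2 * β - 1)) * |u - v| ^ (1 - 2 * β)) *
        ENNReal.ofReal (2 ^ (2 * β - 1) * (M + 1) ^ (1 - 2 * β)) := by
  have h1β : 0 ≤ 1 / (1 - β) := div_nonneg zero_le_one (by linarith)
  have h2β : 0 ≤ 1 / (2 * β - 1) := div_nonneg zero_le_one (by linarith)
  have hdpos : 0 < |u - v| := abs_pos.2 (sub_ne_zero.2 huv)
  have hd : |u - v| ≤ a := by
    rw [abs_le]; constructor <;> linarith [hu.1, hu.2, hv.1, hv.2]
  have h2 : (2 : ℝ) ^ (2 * β - 1) * (M + 1) ^ (1 - 2 * β) = ((M + 1) / 2) ^ (1 - 2 * β) := by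
    rw [Real.div_rpow (by linarith) zero_le_two, div_eq_mul_inv, ← Real.rpow_neg zero_le_two,
      mul_comm]
    congr 2; ring
  rw [h2]
  rcases le_or_gt 1 M with h | h
  · refine (setLIntegral_coordKernel_mul_le hβ (mul_pos ha hM) hu.1.le hv.1.le).trans ?_
    rw [← ENNReal.ofReal_mul (mul_nonneg (by linarith) (Real.rpow_nonneg hdpos.le _))]
    refine ENNReal.ofReal_le_ofReal ?_
    rw [Real.mul_rpow ha.le hM.le, div_eq_inv_mul, ← one_div, mul_assoc]
    refine mul_le_mul (by linarith) (mul_le_mul ?_ ?_ (Real.rpow_nonneg hM.le _)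
      (Real.rpow_nonneg hdpos.le _)) (mul_nonneg (Real.rpow_nonneg ha.le _)
      (Real.rpow_nonneg hM.le _)) (by linarith)
    · exact Real.rpow_le_rpow_of_nonpos hdpos hd (by linarith)
    · exact Real.rpow_le_rpow_of_nonpos (by linarith) (by linarith) (by linarith)
  · refine (setLIntegral_le_lintegral _ _).trans
      ((lintegral_coordKernel_mul_le hβ hβ' huv).trans ?_)
    refine le_mul_of_one_le_right zero_le ?_
    rw [ENNReal.one_le_ofReal]
    exact Real.one_le_rpow_of_pos_of_le_one_of_nonpos (by linarith) (by linarith) (by linarith)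

theorem setLIntegral_setLIntegral_abs_sub_rpow_le {γ a b : ℝ} (hγ : -1 < γ) (hγ0 : γ < 0)
    (ha : 0 < a) :
    ∫⁻ u in Ioc b (b + a), ∫⁻ v in Ioc b (b + a), ENNReal.ofReal (|u - v| ^ γ) ≤
      ENNReal.ofReal (2 / (γ + 1) * a ^ (γ + 2)) := by
  set G : ℝ → ℝ≥0∞ := (Ioc 0 a).indicator fun x => ENNReal.ofReal (x ^ γ) with hG
  have hGm : Measurable G := (by fun_prop : Measurable _).indicator measurableSet_Ioc
  have hGi : ∫⁻ x, G x = ENNReal.ofReal (a ^ (γ + 1) / (γ + 1)) := by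
    rw [lintegral_indicator measurableSet_Ioc, setLIntegral_Ioc_rpow hγ ha.le]
  have hin : ∀ u ∈ Ioc b (b + a), ∫⁻ v in Ioc b (b + a), ENNReal.ofReal (|u - v| ^ γ) ≤
      ENNReal.ofReal (2 / (γ + 1) * a ^ (γ + 1)) := by
    intro u hu
    calc ∫⁻ v in Ioc b (b + a), ENNReal.ofReal (|u - v| ^ γ)
        ≤ ∫⁻ v in Ioc b (b + a), (G (u - v) + G (v - u)) := by
          refine setLIntegral_mono ((hGm.comp (by fun_prop)).add (hGm.comp (by fun_prop)))
            fun v hv => ?_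
          rcases lt_trichotomy u v with h | h | h
          · refine le_add_left ?_
            rw [hG, indicator_of_mem (mem_Ioc.2 ⟨by linarith, by linarith [hu.1, hv.2]⟩),
              abs_sub_comm,
              abs_of_pos (sub_pos.2 h)]
          -- On the diagonal `0 ^ γ = 0` by convention, as `γ ≠ 0`.
          · simp [h, Real.zero_rpow hγ0.ne]
          · refine le_add_right ?_
            rw [hG, indicator_of_mem (mem_Ioc.2 ⟨by linarith, by linarith [hv.1, hu.2]⟩),
              abs_of_pos (sub_pos.2 h)]
      _ ≤ ∫⁻ v, (G (u - v) + G (v - u)) := setLIntegral_le_lintegral _ _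
      _ = ENNReal.ofReal (2 / (γ + 1) * a ^ (γ + 1)) := by
          have hGm' : Measurable fun v => G (u - v) := hGm.comp (by fun_prop)
          rw [lintegral_add_left hGm', lintegral_sub_left_eq_self,
            lintegral_sub_right_eq_self, hGi, ← ENNReal.ofReal_add
            (div_nonneg (Real.rpow_nonneg ha.le _) (by linarith))
            (div_nonneg (Real.rpow_nonneg ha.le _) (by linarith))]
          congr 1; ring
  refine (setLIntegral_mono measurable_const hin).trans ?_
  rw [setLIntegral_const, Real.volume_Ioc, add_sub_cancel_left, ← ENNReal.ofReal_mul
    (mul_nonneg (div_nonneg zero_le_two (by linarith)) (Real.rpow_nonneg ha.le _)), mul_assoc,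
    ← Real.rpow_add_one ha.ne']
  exact le_of_eq (by congr 3; ring)

/-! ### Measurability and pointwise bound of the wavelet kernel -/

theorem productKernel_nonneg (q : ℕ) (H u : ℝ) (y : Fin q → ℝ) : 0 ≤ productKernel q H u y :=
  Finset.prod_nonneg fun i _ => by
    split_ifs with h
    · exact Real.rpow_nonneg (sub_nonneg.2 h.le) _
    · exact le_rfl

theorem enorm_productKernel (q : ℕ) (H u : ℝ) (y : Fin q → ℝ) :
    ‖productKernel q H u y‖ₑ = ∏ i, coordKernel (1 / 2 + (1 - H) / q) u (y i) := by
  rw [Real.enorm_eq_ofReal (productKernel_nonneg q H u y), productKernel,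
    ENNReal.ofReal_prod_of_nonneg]
  · rfl
  · intro i _
    split_ifs with h
    · exact Real.rpow_nonneg (sub_nonneg.2 h.le) _
    · exact le_rfl

theorem measurable_productKernel (q : ℕ) (H : ℝ) :
    Measurable fun p : ℝ × (Fin q → ℝ) => productKernel q H p.1 p.2 := by
  unfold productKernel
  refine Finset.measurable_fun_prod _ fun i _ => Measurable.ite ?_ ?_ measurable_const
  · exact measurableSet_lt (by fun_prop) measurable_fst
  · fun_prop

theorem measurableSet_outerRegion (q : ℕ) (a M : ℝ) (k : ℕ) :
    MeasurableSet (outerRegion q a M k) :=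
  (MeasurableSet.univ_pi fun _ => measurableSet_Iio).diff
    (MeasurableSet.univ_pi fun _ => measurableSet_Ioo)

theorem exists_le_of_mem_outerRegion {q : ℕ} {a M : ℝ} {k : ℕ} {y : Fin q → ℝ}
    (hy : y ∈ outerRegion q a M k) : ∃ i, y i ≤ a * k - a * M := by
  obtain ⟨h1, h2⟩ := hy
  by_contra! hc
  refine h2 fun i _ => ⟨?_, h1 i (mem_univ i)⟩
  rw [mul_sub]
  exact hc i

theorem measurable_checkKernel (q : ℕ) (H : ℝ) {Ψ : ℝ → ℝ} (hΨ : Measurable Ψ) (a M : ℝ) (k : ℕ) :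
    Measurable (checkKernel q H Ψ a M k) := by
  have hk : Measurable fun p : ℝ × (Fin q → ℝ) => hermiteKernel q H p.1 p.2 :=
    (measurable_productKernel q H).const_mul _
  -- An integral over an interval with moving endpoints is an integral over `ℝ` of a jointly
  -- measurable indicator; the interval integral is a difference of two of these.
  have hset : ∀ s t : ℝ × (Fin q → ℝ) → ℝ, Measurable s → Measurable t →
      StronglyMeasurable fun p : ℝ × (Fin q → ℝ) =>
        ∫ u in Ioc (s p) (t p), hermiteKernel q H u p.2 := by
    intro s t hs ht
    have hS : MeasurableSet {z : (ℝ × (Fin q → ℝ)) × ℝ | s z.1 < z.2 ∧ z.2 ≤ t z.1} :=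
      (measurableSet_lt (by fun_prop) measurable_snd).inter
        (measurableSet_le measurable_snd (by fun_prop))
    have hf : Measurable fun z : (ℝ × (Fin q → ℝ)) × ℝ => hermiteKernel q H z.2 z.1.2 :=
      hk.comp (by fun_prop : Measurable fun z : (ℝ × (Fin q → ℝ)) × ℝ => (z.2, z.1.2))
    convert! (hf.indicator hS).stronglyMeasurable.integral_prod_right' (ν := (volume : Measure ℝ))
      using 2 with p
    rw [← integral_indicator measurableSet_Ioc]
    rfl
  have hint : Measurable fun p : ℝ × (Fin q → ℝ) =>
      ∫ u in (a * k)..(a * (p.1 + k)), hermiteKernel q H u p.2 :=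
    ((hset (fun _ => a * k) (fun p => a * (p.1 + k)) (by fun_prop) (by fun_prop)).measurable.sub
      (hset (fun p => a * (p.1 + k)) (fun _ => a * k) (by fun_prop) (by fun_prop)).measurable)
  have hF : Measurable fun p : (Fin q → ℝ) × ℝ => Ψ p.2 * (outerRegion q a M k).indicator
      (fun z => ∫ u in (a * k)..(a * (p.2 + k)), hermiteKernel q H u z) p.1 := by
    refine (hΨ.comp measurable_snd).mul ?_
    have h1 := (hint.comp measurable_swap).indicator
      (measurable_fst (measurableSet_outerRegion q a M k) : MeasurableSet
        (Prod.fst ⁻¹' outerRegion q a M k : Set ((Fin q → ℝ) × ℝ)))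
    exact h1
  exact (hF.stronglyMeasurable.integral_prod_right'
    (ν := (volume : Measure ℝ))).measurable.const_mul _

/-- On the support of `Ψ` one has `0 ≤ x ≤ 1`, so the inner integral is dominated by the one over
all of `(ak, ak + a]`, independently of `x`, and `Ψ` contributes its `L¹` norm. -/
theorem enorm_checkKernel_le {q : ℕ} {H : ℝ} {Ψ : ℝ → ℝ} (hΨ : Continuous Ψ)
    (hs : Function.support Ψ ⊆ Icc 0 1) {a M : ℝ} (ha : 0 < a) (k : ℕ) (y : Fin q → ℝ) :
    ‖checkKernel q H Ψ a M k y‖ₑ ≤ ENNReal.ofReal (√a * |normConst q H| * ∫ x, |Ψ x|) *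
      (outerRegion q a M k).indicator (fun z => ∫⁻ u in Ioc (a * k) (a * k + a),
        ∏ i, coordKernel (1 / 2 + (1 - H) / q) u (z i)) y := by
  by_cases hy : y ∈ outerRegion q a M k
  · simp only [checkKernel, indicator_of_mem hy, enorm_mul]
    set G : ℝ≥0∞ := ∫⁻ u in Ioc (a * k) (a * k + a),
      ∏ i, coordKernel (1 / 2 + (1 - H) / q) u (y i) with hG
    have hΨi : Integrable Ψ := hΨ.integrable_of_hasCompactSupport
      (HasCompactSupport.of_support_subset_isCompact isCompact_Icc hs)
    have hx : ∀ x, ‖Ψ x * ∫ u in (a * k)..(a * (x + k)), hermiteKernel q H u y‖ₑ ≤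
        ‖Ψ x‖ₑ * (‖normConst q H‖ₑ * G) := by
      intro x
      rw [enorm_mul]
      by_cases hx : Ψ x = 0
      · simp [hx]
      · have hx' := hs hx
        refine mul_le_mul_right ?_ _
        have hle : a * k ≤ a * (x + k) := by nlinarith [hx'.1]
        rw [intervalIntegral.integral_of_le hle]
        refine (enorm_integral_le_lintegral_enorm _).trans ?_
        simp only [hermiteKernel, enorm_mul, enorm_productKernel]
        rw [lintegral_const_mul' _ _ (by finiteness)]
        refine mul_le_mul_right (lintegral_mono_set (Ioc_subset_Ioc_right ?_)) _
        nlinarith [hx'.2]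
    have hΨ1 : ∫⁻ x, ‖Ψ x‖ₑ = ENNReal.ofReal (∫ x, |Ψ x|) := by
      rw [ofReal_integral_eq_lintegral_ofReal hΨi.abs (.of_forall fun x => abs_nonneg _)]
      simp only [Real.enorm_eq_ofReal_abs]
    calc ‖√a‖ₑ * ‖∫ x, Ψ x * ∫ u in (a * k)..(a * (x + k)), hermiteKernel q H u y‖ₑ
        ≤ ‖√a‖ₑ * ∫⁻ x, ‖Ψ x‖ₑ * (‖normConst q H‖ₑ * G) :=
          mul_le_mul_right ((enorm_integral_le_lintegral_enorm _).trans (lintegral_mono hx)) _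
      _ = _ := by
          rw [lintegral_mul_const _ hΨ.measurable.enorm, hΨ1, Real.enorm_eq_ofReal_abs,
            Real.enorm_eq_ofReal_abs, abs_of_nonneg (Real.sqrt_nonneg a),
            ENNReal.ofReal_mul (by positivity), ENNReal.ofReal_mul (by positivity)]
          ring
  · simp [checkKernel, indicator_of_notMem hy]

/-! ### Square integral of the kernel over the outer region -/

/-- If every point of `R` has some coordinate in `T`, then the integral over `R` of a product
function gains a factor from the smaller integral over `T`. -/
theorem setLIntegral_prod_le_of_exists_mem {q : ℕ} {g : ℝ → ℝ≥0∞} (hg : Measurable g) {T : Set ℝ}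
    (hT : MeasurableSet T) {R : Set (Fin q → ℝ)} (hR : ∀ y ∈ R, ∃ i, y i ∈ T) {D W : ℝ≥0∞}
    (hD : ∫⁻ s, g s ≤ D) (hW : ∫⁻ s in T, g s ≤ D * W) :
    ∫⁻ y in R, ∏ i, g (y i) ≤ q * (D ^ q * W) := by
  -- `f i₀` cuts the `i₀`-th factor down to `T`; summing over `i₀` covers `R` and costs the factor
  -- `q`.
  set f : Fin q → Fin q → ℝ → ℝ≥0∞ := fun i₀ i => if i = i₀ then T.indicator g else g with hf
  have hfm : ∀ i₀ i, Measurable (f i₀ i) := fun i₀ i => by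
    simp only [hf]; split_ifs
    · exact hg.indicator hT
    · exact hg
  have hfi : ∀ i₀ i, ∫⁻ s, f i₀ i s ≤ D * if i = i₀ then W else 1 := fun i₀ i => by
    simp only [hf]; split_ifs
    · rwa [lintegral_indicator hT]
    · rwa [mul_one]
  have hpt : ∀ y ∈ R, ∏ i, g (y i) ≤ ∑ i₀, ∏ i, f i₀ i (y i) := by
    intro y hy
    obtain ⟨i₀, hi₀⟩ := hR y hy
    refine le_trans (le_of_eq ?_) (Finset.single_le_sum (f := fun i₀ => ∏ i, f i₀ i (y i))
      (fun _ _ => zero_le) (Finset.mem_univ i₀))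
    refine Finset.prod_congr rfl fun i _ => ?_
    simp only [hf]
    split_ifs with h
    · rw [indicator_of_mem (by rwa [h])]
    · rfl
  have hsm : ∀ i₀, Measurable fun y : Fin q → ℝ => ∏ i, f i₀ i (y i) := fun i₀ =>
    Finset.measurable_fun_prod _ fun i _ => (hfm i₀ i).comp (measurable_pi_apply i)
  calc ∫⁻ y in R, ∏ i, g (y i)
      ≤ ∫⁻ y in R, ∑ i₀, ∏ i, f i₀ i (y i) :=
        setLIntegral_mono (Finset.measurable_fun_sum _ fun i₀ _ => hsm i₀) hpt
    _ ≤ ∫⁻ y : Fin q → ℝ, ∑ i₀, ∏ i, f i₀ i (y i) := setLIntegral_le_lintegral _ _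
    _ = ∑ i₀, ∏ i, ∫⁻ s, f i₀ i s := by
        rw [lintegral_finsetSum _ fun i₀ _ => hsm i₀]
        exact Finset.sum_congr rfl fun i₀ _ => lintegral_fin_prod_eq_prod (hfm i₀)
    _ ≤ ∑ i₀ : Fin q, ∏ i, (D * if i = i₀ then W else 1) :=
        Finset.sum_le_sum fun i₀ _ => Finset.prod_le_prod' fun i _ => hfi i₀ i
    _ = q * (D ^ q * W) := by
        simp only [Finset.prod_mul_distrib]
        simp

theorem setLIntegral_outerRegion_le {q : ℕ} {β a M u v : ℝ} {k : ℕ} (hβ : 1 / 2 < β)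
    (hβ' : β < 1) (ha : 0 < a) (hM : 0 < M) (hu : u ∈ Ioc (a * k) (a * k + a))
    (hv : v ∈ Ioc (a * k) (a * k + a)) (huv : u ≠ v) :
    ∫⁻ y in outerRegion q a M k, (∏ i, coordKernel β u (y i)) * ∏ i, coordKernel β v (y i) ≤
      q * (ENNReal.ofReal ((1 / (1 - β) + 1 / (2 * β - 1)) * |u - v| ^ (1 - 2 * β)) ^ q *
        ENNReal.ofReal (2 ^ (2 * β - 1) * (M + 1) ^ (1 - 2 * β))) := by
  simp only [← Finset.prod_mul_distrib]
  exact setLIntegral_prod_le_of_exists_mem (g := fun s => coordKernel β u s * coordKernel β v s)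
    ((measurable_coordKernel_right β u).mul (measurable_coordKernel_right β v)) measurableSet_Iic
    (fun y hy => exists_le_of_mem_outerRegion hy) (lintegral_coordKernel_mul_le hβ hβ' huv)
    (setLIntegral_coordKernel_mul_le_rpow hβ hβ' ha hM hu hv huv)

/-- All `q` coordinates contribute `|u - v|^((2H - 2)/q)`, which multiply to the exponent `2H - 2`.
Only one coordinate is known to be far away, so the power of `M + 1` keeps the denominator `q`. -/
theorem exists_setLIntegral_outerRegion_le {q : ℕ} (hq : 1 ≤ q) {H : ℝ} (hH : 1 / 2 < H)
    (hH' : H < 1) :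
    ∃ C : ℝ, 0 ≤ C ∧ ∀ (a M : ℝ) (k : ℕ), 0 < a → 0 < M →
      ∀ u ∈ Ioc (a * k) (a * k + a), ∀ v ∈ Ioc (a * k) (a * k + a), u ≠ v →
      ∫⁻ y in outerRegion q a M k, (∏ i, coordKernel (1 / 2 + (1 - H) / q) u (y i)) *
        ∏ i, coordKernel (1 / 2 + (1 - H) / q) v (y i) ≤
      ENNReal.ofReal (C * (M + 1) ^ ((2 * H - 2) / q) * |u - v| ^ (2 * H - 2)) := by
  have hq0 : (0 : ℝ) < q := by exact_mod_cast hq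
  have hq1 : (1 : ℝ) ≤ q := by exact_mod_cast hq
  obtain ⟨β, hβdef⟩ : ∃ β : ℝ, β = 1 / 2 + (1 - H) / q := ⟨_, rfl⟩
  rw [← hβdef]
  have hβ : 1 / 2 < β := by
    have : 0 < (1 - H) / q := div_pos (by linarith) hq0
    linarith
  have hβ' : β < 1 := by
    have : (1 - H) / q ≤ 1 - H := div_le_self (by linarith) hq1
    linarith
  have hC₀ : 0 ≤ 1 / (1 - β) + 1 / (2 * β - 1) :=
    add_nonneg (div_nonneg zero_le_one (by linarith)) (div_nonneg zero_le_one (by linarith))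
  have he : 1 - 2 * β = (2 * H - 2) / q := by rw [hβdef]; field_simp; ring
  refine ⟨q * ((1 / (1 - β) + 1 / (2 * β - 1)) ^ q * 2 ^ (2 * β - 1)), by positivity,
    fun a M k ha hM u hu v hv huv => ?_⟩
  have hM1 : 0 < M + 1 := by linarith
  refine (setLIntegral_outerRegion_le hβ hβ' ha hM hu hv huv).trans (le_of_eq ?_)
  have habs : (|u - v| ^ (1 - 2 * β)) ^ q = |u - v| ^ (2 * H - 2) := by
    rw [← Real.rpow_mul_natCast (abs_nonneg _), he, div_mul_cancel₀ _ hq0.ne']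
  rw [← ENNReal.ofReal_pow (by positivity), ← ENNReal.ofReal_mul (by positivity),
    ← ENNReal.ofReal_natCast, ← ENNReal.ofReal_mul (by positivity), mul_pow, habs, he]
  congr 1
  ring

theorem exists_lintegral_checkKernel_sq_le {q : ℕ} (hq : 1 ≤ q) {H : ℝ} (hH : 1 / 2 < H)
    (hH' : H < 1) :
    ∃ C : ℝ, 0 ≤ C ∧ ∀ Ψ : ℝ → ℝ, Continuous Ψ → Function.support Ψ ⊆ Icc 0 1 →
      ∀ (a M : ℝ) (k : ℕ), 0 < a → 0 < M →
      ∫⁻ y, ‖checkKernel q H Ψ a M k y‖ₑ ^ 2 ≤ ENNReal.ofReal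
        (C * (∫ x, |Ψ x|) ^ 2 * a ^ (2 * H + 1) * (M + 1) ^ ((2 * H - 2) / q)) := by
  obtain ⟨C, hC, hbound⟩ := exists_setLIntegral_outerRegion_le hq hH hH'
  refine ⟨normConst q H ^ 2 * C * (2 / (2 * H - 2 + 1)),
    mul_nonneg (by positivity) (div_nonneg zero_le_two (by linarith)),
    fun Ψ hΨ hs a M k ha hM => ?_⟩
  have hM1 : 0 < M + 1 := by linarith
  set b : ℝ := a * k with hb
  set S : Set ℝ := Ioc b (b + a) with hS
  set μ : Measure ℝ := volume.restrict S with hμ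
  set p : ℝ → (Fin q → ℝ) → ℝ≥0∞ := fun u y =>
    ∏ i, coordKernel (1 / 2 + (1 - H) / q) u (y i) with hp
  have hpm : Measurable fun z : ℝ × (Fin q → ℝ) => p z.1 z.2 :=
    Finset.measurable_fun_prod _ fun i _ => (measurable_coordKernel _).comp
      (by fun_prop : Measurable fun z : ℝ × (Fin q → ℝ) => (z.1, z.2 i))
  have hpu : ∀ y, Measurable fun u => p u y := fun y => hpm.comp measurable_prodMk_right
  have hO := measurableSet_outerRegion q a M k
  set A : ℝ := √a * |normConst q H| * ∫ x, |Ψ x| with hA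
  have hΨ0 : 0 ≤ ∫ x, |Ψ x| := integral_nonneg fun x => abs_nonneg _
  have hA0 : 0 ≤ A := by positivity
  have hA2 : A ^ 2 = a * normConst q H ^ 2 * (∫ x, |Ψ x|) ^ 2 := by
    rw [hA, mul_pow, mul_pow, Real.sq_sqrt ha.le, sq_abs]
  have hF : Measurable fun w : (Fin q → ℝ) × (ℝ × ℝ) => p w.2.1 w.1 * p w.2.2 w.1 :=
    (hpm.comp (by fun_prop : Measurable fun w : (Fin q → ℝ) × (ℝ × ℝ) => (w.2.1, w.1))).mul
      (hpm.comp (by fun_prop : Measurable fun w : (Fin q → ℝ) × (ℝ × ℝ) => (w.2.2, w.1)))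
  set E : ℝ := C * (M + 1) ^ ((2 * H - 2) / q) with hE
  have hE0 : 0 ≤ E := by positivity
  calc ∫⁻ y, ‖checkKernel q H Ψ a M k y‖ₑ ^ 2
      ≤ ∫⁻ y, ENNReal.ofReal (A ^ 2) *
          (outerRegion q a M k).indicator (fun z => ∫⁻ w, p w.1 z * p w.2 z ∂(μ.prod μ)) y := by
        refine lintegral_mono fun y => ?_
        refine (pow_le_pow_left' (enorm_checkKernel_le hΨ hs ha k y) 2).trans (le_of_eq ?_)
        rw [mul_pow, ← ENNReal.ofReal_pow hA0]
        congr 1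
        by_cases hy : y ∈ outerRegion q a M k
        · rw [indicator_of_mem hy, indicator_of_mem hy,
            lintegral_prod_mul (hpu y).aemeasurable (hpu y).aemeasurable, sq]
        · rw [indicator_of_notMem hy, indicator_of_notMem hy]
          simp
    _ = ENNReal.ofReal (A ^ 2) *
          ∫⁻ w, (∫⁻ y in outerRegion q a M k, p w.1 y * p w.2 y) ∂(μ.prod μ) := by
        rw [lintegral_const_mul' _ _ ENNReal.ofReal_ne_top, lintegral_indicator hO,
          lintegral_lintegral_swap hF.aemeasurable]
    _ = ENNReal.ofReal (A ^ 2) * ∫⁻ u in S, ∫⁻ v in S, ∫⁻ y in outerRegion q a M k,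
          p u y * p v y := by
        congr 1
        exact lintegral_prod _ (hF.lintegral_prod_left').aemeasurable
    _ ≤ ENNReal.ofReal (A ^ 2) * ∫⁻ u in S, ∫⁻ v in S,
          ENNReal.ofReal E * ENNReal.ofReal (|u - v| ^ (2 * H - 2)) := by
        refine mul_le_mul_right ?_ _
        refine lintegral_mono_ae ?_
        filter_upwards [ae_restrict_mem measurableSet_Ioc] with u hu
        refine lintegral_mono_ae ?_
        -- The overlap bound needs `u ≠ v`; the excluded point `v = u` is null.
        filter_upwards [ae_restrict_mem measurableSet_Ioc,
          ae_restrict_of_ae (Measure.ae_ne volume u)] with v hv hne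
        rw [← ENNReal.ofReal_mul hE0]
        exact hbound a M k ha hM u hu v hv hne.symm
    _ = ENNReal.ofReal (A ^ 2) * (ENNReal.ofReal E * ∫⁻ u in S, ∫⁻ v in S,
          ENNReal.ofReal (|u - v| ^ (2 * H - 2))) := by
        simp only [lintegral_const_mul' _ _ ENNReal.ofReal_ne_top]
    _ ≤ ENNReal.ofReal (A ^ 2) * (ENNReal.ofReal E *
          ENNReal.ofReal (2 / (2 * H - 2 + 1) * a ^ (2 * H - 2 + 2))) := by
        gcongr
        exact setLIntegral_setLIntegral_abs_sub_rpow_le (by linarith) (by linarith) ha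
    _ = _ := by
        rw [← ENNReal.ofReal_mul hE0, ← ENNReal.ofReal_mul (by positivity), hA2, hE]
        congr 1
        rw [show 2 * H - 2 + 2 = 2 * H by ring, Real.rpow_add_one ha.ne']
        ring

end HermiteWavelet

theorem mainTheorem9 (q : ℕ) (hq : 1 ≤ q) (H : ℝ) (hH : 1 / 2 < H) (hH' : H < 1) :
    ∃ C : ℝ, 0 < C ∧
      ∀ {Ω : Type*} [MeasurableSpace Ω] (P : Measure Ω) [IsProbabilityMeasure P] (B : ℝ → Ω → ℝ),
        HermiteWavelet.IsTwoSidedBrownianMotion B P →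
      ∀ Ψ : ℝ → ℝ, ContDiff ℝ 1 Ψ → Function.support Ψ ⊆ Icc 0 1 → ∫ x, Ψ x = 0 →
      ∀ (a M : ℝ) (k : ℕ), 0 < a → 0 < M →
        HermiteWavelet.IsMultipleIntegral P B (HermiteWavelet.checkKernel q H Ψ a M k)
            (HermiteWavelet.checkCoeff P B q H Ψ a M k) ∧
          ∫ ω, (HermiteWavelet.checkCoeff P B q H Ψ a M k ω) ^ 2 ∂P ≤
            C * (∫ x, |Ψ x|) ^ 2 * a ^ (2 * H + 1) * (M + 1) ^ ((2 * H - 2) / q) := by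
  obtain ⟨C, hC, hbound⟩ := HermiteWavelet.exists_lintegral_checkKernel_sq_le hq hH hH'
  -- `(q^q)^2` is the squared operator bound; `+ 1` ensures positivity, as only `0 ≤ C` is known.
  refine ⟨((q : ℝ) ^ q) ^ 2 * C + 1, by positivity, ?_⟩
  intro Ω _ P _ B hB Ψ hΨ hs _ a M k ha hM
  have hM1 : 0 < M + 1 := by linarith
  have hb := hbound Ψ hΨ.continuous hs a M k ha hM
  have hmem : MemLp (HermiteWavelet.checkKernel q H Ψ a M k) 2 volume := by
    refine ⟨(HermiteWavelet.measurable_checkKernel q H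
      hΨ.continuous.measurable a M k).aestronglyMeasurable, ?_⟩
    have h := hb.trans_lt ENNReal.ofReal_lt_top
    rw [← HermiteWavelet.eLpNorm_two_sq_eq_lintegral] at h
    exact (ENNReal.pow_lt_top_iff.1 h).resolve_right two_ne_zero
  refine ⟨HermiteWavelet.isMultipleIntegral_multipleIntegral hB hmem, ?_⟩
  have hI : 0 ≤ (∫ x, |Ψ x|) ^ 2 * a ^ (2 * H + 1) * (M + 1) ^ ((2 * H - 2) / q) := by positivity
  refine (HermiteWavelet.integral_multipleIntegral_sq_le hB hmem (by positivity) hb).trans ?_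
  linarith
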